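/- Let $G$ be a countable discrete group with a sofic approximation $\Sigma=(\sigma_n)_{n\ge1}$: maps $\sigma_n:G\to\mathrm{Sym}(V_n)$, with $V_n$ nonempty finite sets, such that for all $g,h\in G$ the proportion of $v\in V_n$ with $\sigma_n^g(\sigma_n^h(v))=\sigma_n^{gh}(v)$ tends to $1$, and for all $g\neq e$ the proportion of $v\in V_n$ with $\sigma_n^g(v)\ne v$ tends to $1$. A $G$-system $(X,\mu,T)$ is a standard probability space $(X,\mu)$ with a measurable, $\mu$-preserving action $T$ of $G$. **Sofic entropy.** Let $d$ be a compact metric on $X$ generating its $\sigma$-algebra, let $\tilde\mu\in\Pr(X^G)$ be the law of $x\mapsto(T^hx)_{h\in G}$ under $\mu$, and set $d^{(V)}(\mathbf x,\mathbf y)=\frac1{|V|}\sum_{v\in V}d(x_v,y_v)$ on $X^V$. For $\mathcal O\subseteq\Pr(X^G)$ let $$\Omega(\mathcal O,\sigma_n)=\Big\{\mathbf x\in X^{V_n}:\ \tfrac1{|V_n|}\sum_{v\in V_n}\delta_{(x_{\sigma_n^g(v)})_{g\in G}}\in\mathcal O\Big\}.$$ Let $\mathrm{cov}_\delta(Z,d)$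 be the least cardinality of a subset of $Z$ whose open $\delta$-neighbourhood contains $Z$. Then, with $\log 0=-\infty$, $$\mathrm h_\Sigma(\mu,T)=\sup_{\delta>0}\inf_{\mathcal O}\limsup_{n\to\infty}\frac1{|V_n|}\log\mathrm{cov}_\delta\big(\Omega(\mathcal O,\sigma_n),d^{(V_n)}\big)\in[-\infty,+\infty],$$ where $\mathcal O$ ranges over the weak$^*$-neighbourhoods of $\tilde\mu$. The lower sofic entropy $\underline{\mathrm h}_\Sigma(\mu,T)$ is defined with $\liminf$ in place of $\limsup$. Neither value depends on the choice of $d$ (formally, one may take the supremum over all such $d$). The power-stabilized sofic entropy is $$\mathrm h^{\mathrm{ps}}_\Sigma(\mu,T)=\lim_{k\to\infty}\frac1k\,\mathrm h_\Sigma(\mu^{\times k},T^{\times k}).$$ A finite measurable partition $\mathcal P$ of $X$ is generating if every measurable set agrees up to a $\mu$-null set with a member of the $\sigma$-algebra generated by the translates of the cells of $\mathcal P$ under $T$. **Statement.** Let $(X,\mu,T)$ and $(Y,\nu,S)$ be $G$-systems. Suppose that $(X,\mu,T)$ has a finite generating partition and that $$\mathrm h_\Sigma(\nu^{\times k},S^{\times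 k})=\underline{\mathrm h}_\Sigma(\nu^{\times k},S^{\times k})\qquad\text{for all }k\ge1.$$ Then the limits defining $\mathrm h^{\mathrm{ps}}_\Sigma$ for $(X,\mu,T)$, $(Y,\nu,S)$ and $(X\times Y,\mu\times\nu,T\times S)$ exist in $[-\infty,+\infty]$, and $$\mathrm h^{\mathrm{ps}}_\Sigma(\mu\times\nu,T\times S)=\mathrm h^{\mathrm{ps}}_\Sigma(\mu,T)+\mathrm h^{\mathrm{ps}}_\Sigma(\nu,S),$$ where the right-hand side is read as $-\infty$ if either of its terms is $-\infty$. -/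

import Mathlib

open MeasureTheory Filter Topology

noncomputable section

namespace SoficEntropy

/-! ### Sofic approximations -/

/-- The proportion of points of the finite set `V` that have the property `p`. -/
def proportion {V : Type*} [Fintype V] (p : V → Prop) : ℝ :=
  (Nat.card {v : V // p v} : ℝ) / (Fintype.card V : ℝ)

/-- A sofic approximation to `G`: maps `σ n : G → Sym (V n)` into the symmetric groups of nonempty
finite sets which are asymptotically multiplicative and asymptotically free, at all but a vanishing
proportion of points. -/
structure SoficApproximation (G : Type*) [Group G] where
  V : ℕ → Type
  fintypeV : ∀ n, Fintype (V n)
  nonemptyV : ∀ n, Nonempty (V n)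
  σ : ∀ n, G → Equiv.Perm (V n)
  asymp_mul : ∀ g h : G,
    Tendsto (fun n => proportion fun v : V n => σ n g (σ n h v) = σ n (g * h) v) atTop (𝓝 1)
  asymp_free : ∀ g : G, g ≠ 1 →
    Tendsto (fun n => proportion fun v : V n => σ n g v ≠ v) atTop (𝓝 1)

attribute [instance] SoficApproximation.fintypeV SoficApproximation.nonemptyV

/-! ### Empirical distributions and good models -/

/-- The pullback name of `x : V → A` at `v`, an element of the shift space `G → A`. -/
def pullbackName {G A V : Type*} (σ : G → Equiv.Perm V) (x : V → A) (v : V) : G → A :=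
  fun g => x (σ g v)

/-- The empirical distribution of `x`: the uniform average over `v` of the point masses at the
pullback names of `x`. -/
def empirical {G A V : Type*} [MeasurableSpace A] [Fintype V] [Nonempty V]
    (σ : G → Equiv.Perm V) (x : V → A) : ProbabilityMeasure (G → A) :=
  ⟨(Fintype.card V : ENNReal)⁻¹ • ∑ v : V, Measure.dirac (pullbackName σ x v), ⟨by
    simp only [Measure.smul_apply, Measure.finsetSum_apply, measure_univ, Finset.sum_const,
      Finset.card_univ, smul_eq_mul, nsmul_eq_mul, mul_one]
    exact ENNReal.inv_mul_cancel (by simp) (by simp)⟩⟩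

/-- The models over `σ` whose empirical distribution lies in `O`. -/
def goodModels {G A V : Type*} [MeasurableSpace A] [Fintype V] [Nonempty V]
    (O : Set (ProbabilityMeasure (G → A))) (σ : G → Equiv.Perm V) : Set (V → A) :=
  {x | empirical σ x ∈ O}

/-! ### Covering numbers -/

/-- The Hamming average over `V` of the metric of `A`. -/
def hammingAverage {A V : Type*} [MetricSpace A] [Fintype V] (x y : V → A) : ℝ :=
  (∑ v, dist (x v) (y v)) / (Fintype.card V : ℝ)

/-- The least cardinality of a subset of `Z` whose open `δ`-neighbourhood, for the distance
function `d`, contains `Z`. -/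
def cov {B : Type*} (δ : ℝ) (Z : Set B) (d : B → B → ℝ) : ℕ∞ :=
  ⨅ (F : Set B) (_ : F ⊆ Z) (_ : ∀ z ∈ Z, ∃ y ∈ F, d z y < δ), F.encard

/-- `|V n|⁻¹ log cov_δ (Ω(O, σ n))`, which is `-∞` if there are no `O`-good models. -/
def modelRate {G : Type*} [Group G] (S : SoficApproximation G) {A : Type*} [MeasurableSpace A]
    [MetricSpace A] (δ : ℝ) (O : Set (ProbabilityMeasure (G → A))) (n : ℕ) : EReal :=
  ENNReal.log ((cov δ (goodModels O (S.σ n)) hammingAverage : ℕ∞) : ENNReal) /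
    ((Fintype.card (S.V n) : ℕ) : EReal)

/-! ### Sofic entropy of metric processes -/

/-- Sofic entropy of the metric process given by a law `μ` on `G → A`, where `A` has a compact
metric; `O` runs over the weak-star neighbourhoods of `μ`. -/
def processEntropy {G : Type*} [Group G] [Countable G] (S : SoficApproximation G) {A : Type*}
    [MeasurableSpace A] [MetricSpace A] [CompactSpace A] [BorelSpace A]
    (μ : ProbabilityMeasure (G → A)) : EReal :=
  ⨆ (δ : ℝ) (_ : 0 < δ), ⨅ O ∈ 𝓝 μ, limsup (modelRate S δ O) atTop

/-- Lower sofic entropy of a metric process. -/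
def lowerProcessEntropy {G : Type*} [Group G] [Countable G] (S : SoficApproximation G) {A : Type*}
    [MeasurableSpace A] [MetricSpace A] [CompactSpace A] [BorelSpace A]
    (μ : ProbabilityMeasure (G → A)) : EReal :=
  ⨆ (δ : ℝ) (_ : 0 < δ), ⨅ O ∈ 𝓝 μ, liminf (modelRate S δ O) atTop

/-! ### Sofic entropy of systems

A `G`-system is a standard Borel space `X` with a measurable action of `G` and an invariant
probability measure `μ`. -/

/-- The diagonal action on a product of two systems is measurable. -/
instance measurableConstSMul_prod {G X Y : Type*} [SMul G X] [SMul G Y] [MeasurableSpace X]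
    [MeasurableSpace Y] [MeasurableConstSMul G X] [MeasurableConstSMul G Y] :
    MeasurableConstSMul G (X × Y) :=
  ⟨fun g => ((measurable_const_smul g).comp measurable_fst).prodMk
    ((measurable_const_smul g).comp measurable_snd)⟩

/-- A compact metric on `X` whose Borel sets are the given measurable sets. -/
structure CompactGeneratingMetric (X : Type*) [MeasurableSpace X] where
  metric : MetricSpace X
  compact : CompactSpace X
  borel : BorelSpace X

/-- A measurable equivalence with a compact metrizable space gives a compact generating metric. -/
theorem compactGeneratingMetric_of_equiv {X K : Type*} [MeasurableSpace X] [TopologicalSpace K]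
    [CompactSpace K] [TopologicalSpace.MetrizableSpace K] [MeasurableSpace K] [BorelSpace K]
    (e : X ≃ᵐ K) : Nonempty (CompactGeneratingMetric X) := by
  let _ : MetricSpace K := TopologicalSpace.metrizableSpaceMetric K
  let m : MetricSpace X := MetricSpace.induced e e.injective inferInstance
  have hi : Topology.IsInducing e := ⟨rfl⟩
  have hh : IsHomeomorph e := ⟨hi.continuous,
    Topology.IsInducing.isOpenMap hi (by rw [e.surjective.range_eq]; exact isOpen_univ),
    e.bijective⟩
  exact ⟨⟨m, (hh.homeomorph e).symm.compactSpace, e.measurableEmbedding.borelSpace hi⟩⟩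

/-- Every standard Borel space has a compact generating metric. -/
theorem nonempty_compactGeneratingMetric (X : Type*) [MeasurableSpace X] [StandardBorelSpace X] :
    Nonempty (CompactGeneratingMetric X) := by
  by_cases hX : Countable X
  · let _ : MeasurableSpace (OnePoint ℕ) := borel _
    have : BorelSpace (OnePoint ℕ) := ⟨rfl⟩
    cases finite_or_infinite X
    · obtain ⟨n, ⟨e⟩⟩ := Finite.exists_equiv_fin X
      exact compactGeneratingMetric_of_equiv (K := Fin n)
        ⟨e, fun s _ => (Set.toFinite _).measurableSet, fun s _ => (Set.toFinite _).measurableSet⟩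
    · have : Countable (OnePoint ℕ) := inferInstanceAs (Countable (Option ℕ))
      have : Infinite (OnePoint ℕ) := inferInstanceAs (Infinite (Option ℕ))
      obtain ⟨e⟩ := nonempty_equiv_of_countable (α := X) (β := OnePoint ℕ)
      exact compactGeneratingMetric_of_equiv (K := OnePoint ℕ)
        ⟨e, fun s _ => (Set.to_countable _).measurableSet,
          fun s _ => (Set.to_countable _).measurableSet⟩
  · exact compactGeneratingMetric_of_equiv (PolishSpace.measurableEquivNatBoolOfNotCountable hX)

/-- The law on `G → X` of the orbit map `x ↦ (h • x)_h`. This map is an isomorphism from the system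
to a process with state space `X`. -/
def orbitLaw (G : Type*) [Group G] {X : Type*} [MeasurableSpace X] [MulAction G X]
    [MeasurableConstSMul G X] (μ : Measure X) [IsProbabilityMeasure μ] :
    ProbabilityMeasure (G → X) :=
  ⟨μ.map fun x h => h • x,
    Measure.isProbabilityMeasure_map
      (measurable_pi_lambda _ fun h => measurable_const_smul h).aemeasurable⟩

/-- Sofic entropy of the system `(X, μ)`: that of its orbit process, for a compact generating
metric on `X`. The value is the same for every such metric; the supremum makes the definition
free of a choice. -/
def soficEntropy {G : Type*} [Group G] [Countable G] (S : SoficApproximation G) {X : Type*}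
    [MeasurableSpace X] [MulAction G X] [MeasurableConstSMul G X] (μ : Measure X)
    [IsProbabilityMeasure μ] : EReal :=
  ⨆ d : CompactGeneratingMetric X,
    letI := d.metric
    haveI := d.compact
    haveI := d.borel
    processEntropy S (orbitLaw G μ)

/-- Lower sofic entropy of the system `(X, μ)`. -/
def lowerSoficEntropy {G : Type*} [Group G] [Countable G] (S : SoficApproximation G) {X : Type*}
    [MeasurableSpace X] [MulAction G X] [MeasurableConstSMul G X] (μ : Measure X)
    [IsProbabilityMeasure μ] : EReal :=
  ⨆ d : CompactGeneratingMetric X,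
    letI := d.metric
    haveI := d.compact
    haveI := d.borel
    lowerProcessEntropy S (orbitLaw G μ)

/-- The measure of the `k`-th Cartesian power; `G` acts diagonally on `Fin k → X`. -/
abbrev power {X : Type*} [MeasurableSpace X] (μ : Measure X) (k : ℕ) : Measure (Fin k → X) :=
  Measure.pi fun _ => μ

/-- `h(μ^k) / k`, relevant for `k ≥ 1`. -/
def powerRate {G : Type*} [Group G] [Countable G] (S : SoficApproximation G) {X : Type*}
    [MeasurableSpace X] [MulAction G X] [MeasurableConstSMul G X] (μ : Measure X)
    [IsProbabilityMeasure μ] (k : ℕ) : EReal :=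
  soficEntropy S (power μ k) / (k : EReal)

/-- Power-stabilized sofic entropy: the limit (superior) of `h(μ^k) / k` as `k → ∞`. -/
def psEntropy {G : Type*} [Group G] [Countable G] (S : SoficApproximation G) {X : Type*}
    [MeasurableSpace X] [MulAction G X] [MeasurableConstSMul G X] (μ : Measure X)
    [IsProbabilityMeasure μ] : EReal :=
  limsup (powerRate S μ) atTop

/-- There is a finite measurable partition `P` of `X` such that every measurable set agrees, up to
a null set, with a member of the σ-algebra generated by the translates of the cells of `P`. -/
def HasFiniteGeneratingPartition (G : Type*) [Group G] {X : Type*} [MeasurableSpace X]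
    [MulAction G X] (μ : Measure X) : Prop :=
  ∃ (m : ℕ) (P : Fin m → Set X),
    (∀ i, MeasurableSet (P i)) ∧ Pairwise (Function.onFun Disjoint P) ∧ (⋃ i, P i) = Set.univ ∧
    ∀ A : Set X, MeasurableSet A → ∃ B : Set X,
      MeasurableSet[MeasurableSpace.generateFrom
        {C | ∃ (g : G) (i : Fin m), C = (fun x => g • x) ⁻¹' P i}] B ∧ A =ᵐ[μ] B

end SoficEntropy

end

noncomputable section

namespace SoficEntropy

/-! ### Covering numbers -/

/-! Everything rests on one invariance principle. If two observables on a system determine each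
other almost surely, their processes have the same entropy. Measurable codes are approximated in
mean by continuous ones, which depend approximately on finitely many coordinates. Hence good models
of one process lift to good joint models (`exists_lift_goodModels`), and closeness of the second
coordinates of good joint models forces closeness of the first (`exists_separation`). This makes
entropy an isomorphism invariant and, with the product bound for covering numbers, subadditive under
joinings (`soficEntropy_le_add`).

Limits and upper bound. The power `μ^k` is a joining of two of its blocks of coordinates as soon as
they cover all coordinates, even when they overlap. With values in `{-∞} ∪ [0,∞]`, this gives
`limsup h(μ^k)/k ≤ h(μ^m)/m` for every `m ≥ 1`, so the limit exists and is the infimum.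
Subadditivity applied to the powers of the product gives "≤".

Lower bound. A finite generating partition allows a finite alphabet for `μ`. A good model of `μ^k`
is a `k`-tuple of models whose pairs look independent, so a centred test function evaluated along
them gives almost orthogonal vectors. By a Bessel-type inequality, a fixed good model `y` of `ν`
correlates with only boundedly many of them. So all but `N₀` entries `x` of the tuple make `(x, y)`
a good model of the product, with `N₀` independent of `k` and `y` (`exists_card_bad_le`). If `h(μ^k)
> ka` for all `k`, counting tuples with `k` large compared with `N₀` shows that every good `y` has
about `exp(a|V|)` or more partners `x`. A disjoint-family argument then multiplies this number by
the covering number of the good `y` (`exists_cov_le_and_mul_le`). The partners are available for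
infinitely many `n` only, so the models `y` must be plentiful for all large `n`; this is the role of
the lower entropy of `ν`. Applied to `μ^j` and `ν^j`, this yields "≥" at every level `j`. -/

theorem cov_le_encard {B : Type*} {δ : ℝ} {Z F : Set B} {d : B → B → ℝ} (hF : F ⊆ Z)
    (h : ∀ z ∈ Z, ∃ y ∈ F, d z y < δ) : cov δ Z d ≤ F.encard :=
  iInf_le_of_le F <| iInf_le_of_le hF <| iInf_le_of_le h le_rfl

/-- The infimum is attained because `ℕ∞` is well ordered and `Z` covers itself. -/
theorem exists_encard_eq_cov {B : Type*} {δ : ℝ} {Z : Set B} {d : B → B → ℝ}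
    (hd : ∀ z ∈ Z, d z z < δ) :
    ∃ F ⊆ Z, (∀ z ∈ Z, ∃ y ∈ F, d z y < δ) ∧ F.encard = cov δ Z d := by
  let s : Set ℕ∞ := {c | ∃ F ⊆ Z, (∀ z ∈ Z, ∃ y ∈ F, d z y < δ) ∧ F.encard = c}
  have hs : s.Nonempty := ⟨_, Z, subset_rfl, fun z hz => ⟨z, hz, hd z hz⟩, rfl⟩
  obtain ⟨F, hF, hc, he⟩ := csInf_mem hs
  refine ⟨F, hF, hc, le_antisymm ?_ (cov_le_encard hF hc)⟩
  rw [he]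
  exact le_iInf fun F' => le_iInf fun h1 => le_iInf fun h2 => sInf_le ⟨F', h1, h2, rfl⟩

/-- Labels which determine a point up to `δ` bound the covering number. -/
theorem cov_le_of_label {B ι : Type*} {δ : ℝ} {Z : Set B} {d : B → B → ℝ} {T : Set ι} (c : B → ι)
    (hc : ∀ z ∈ Z, c z ∈ T) (h : ∀ z ∈ Z, ∀ z' ∈ Z, c z = c z' → d z z' < δ) :
    cov δ Z d ≤ T.encard := by
  have hex : ∀ t : ↥(c '' Z), ∃ z ∈ Z, c z = t := fun t => t.2
  choose r hr hcr using hex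
  refine (cov_le_encard (F := Set.range r) ?_ ?_).trans ?_
  · rintro _ ⟨t, rfl⟩; exact hr t
  · intro z hz
    exact ⟨r ⟨c z, z, hz, rfl⟩, ⟨_, rfl⟩, h z hz _ (hr _) (hcr ⟨c z, z, hz, rfl⟩).symm⟩
  · rw [← Set.image_univ]
    refine (Set.encard_image_le _ _).trans ?_
    rw [Set.encard_univ, ENat.card_coe_set_eq]
    exact Set.encard_le_encard (by rintro _ ⟨z, hz, rfl⟩; exact hc z hz)

/-- Label `z` by a centre near `f₁ z` and a centre near `f₂ z`: equal labels force `δ`-closeness,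
and there are at most as many labels as pairs of centres. The centres need not come from points of
`Z`, since `cov_le_of_label` picks representatives inside `Z`. -/
theorem cov_le_cov_mul_cov {B B₁ B₂ : Type*} {δ δ₁ δ₂ : ℝ} {Z : Set B} {Z₁ : Set B₁} {Z₂ : Set B₂}
    {d : B → B → ℝ} {d₁ : B₁ → B₁ → ℝ} {d₂ : B₂ → B₂ → ℝ} (f₁ : B → B₁) (f₂ : B → B₂)
    (h₁ : Set.MapsTo f₁ Z Z₁) (h₂ : Set.MapsTo f₂ Z Z₂)
    (hd₁ : ∀ z ∈ Z₁, d₁ z z < δ₁) (hd₂ : ∀ z ∈ Z₂, d₂ z z < δ₂)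
    (h : ∀ z ∈ Z, ∀ z' ∈ Z, ∀ w₁ ∈ Z₁, ∀ w₂ ∈ Z₂, d₁ (f₁ z) w₁ < δ₁ → d₁ (f₁ z') w₁ < δ₁ →
      d₂ (f₂ z) w₂ < δ₂ → d₂ (f₂ z') w₂ < δ₂ → d z z' < δ) :
    cov δ Z d ≤ cov δ₁ Z₁ d₁ * cov δ₂ Z₂ d₂ := by
  obtain ⟨F₁, hF₁, hc₁, he₁⟩ := exists_encard_eq_cov hd₁
  obtain ⟨F₂, hF₂, hc₂, he₂⟩ := exists_encard_eq_cov hd₂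
  have k₁ : ∀ z : B, ∃ y, z ∈ Z → y ∈ F₁ ∧ d₁ (f₁ z) y < δ₁ := fun z => by
    by_cases hz : z ∈ Z
    · obtain ⟨y, hy⟩ := hc₁ _ (h₁ hz); exact ⟨y, fun _ => hy⟩
    · exact ⟨f₁ z, fun h => absurd h hz⟩
  have k₂ : ∀ z : B, ∃ y, z ∈ Z → y ∈ F₂ ∧ d₂ (f₂ z) y < δ₂ := fun z => by
    by_cases hz : z ∈ Z
    · obtain ⟨y, hy⟩ := hc₂ _ (h₂ hz); exact ⟨y, fun _ => hy⟩
    · exact ⟨f₂ z, fun h => absurd h hz⟩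
  choose c₁ hc₁' using k₁
  choose c₂ hc₂' using k₂
  refine (cov_le_of_label (T := F₁ ×ˢ F₂) (fun z => (c₁ z, c₂ z))
    (fun z hz => ⟨(hc₁' z hz).1, (hc₂' z hz).1⟩) ?_).trans ?_
  · intro z hz z' hz' he
    have e₁ := congrArg Prod.fst he
    have e₂ := congrArg Prod.snd he
    simp only at e₁ e₂
    refine h z hz z' hz' (c₁ z) (hF₁ (hc₁' z hz).1) (c₂ z) (hF₂ (hc₂' z hz).1) (hc₁' z hz).2 ?_
      (hc₂' z hz).2 ?_
    · rw [e₁]; exact (hc₁' z' hz').2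
    · rw [e₂]; exact (hc₂' z' hz').2
  · rw [← he₁, ← he₂, Set.encard_prod]

theorem cov_le_cov_of_map {B B' : Type*} {δ δ' : ℝ} {Z : Set B} {Z' : Set B'}
    {d : B → B → ℝ} {d' : B' → B' → ℝ} (f : B → B') (hf : Set.MapsTo f Z Z')
    (hd : ∀ z ∈ Z', d' z z < δ')
    (h : ∀ z ∈ Z, ∀ z' ∈ Z, ∀ w ∈ Z', d' (f z) w < δ' → d' (f z') w < δ' → d z z' < δ) :
    cov δ Z d ≤ cov δ' Z' d' := by
  have := cov_le_cov_mul_cov (Z := Z) (δ := δ) (d := d) (Z₂ := (Set.univ : Set Unit))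
    (d₂ := fun _ _ => 0) (δ₂ := 1) f (fun _ => ()) hf (fun _ _ => trivial) hd (by simp)
    (fun z hz z' hz' w hw _ _ a b _ _ => h z hz z' hz' w hw a b)
  refine this.trans ?_
  have h1 : cov 1 (Set.univ : Set Unit) (fun _ _ => 0) ≤ 1 := by
    refine (cov_le_encard subset_rfl (by simp)).trans (by simp)
  calc _ ≤ cov δ' Z' d' * 1 := by gcongr
    _ = _ := mul_one _

theorem cov_eq_zero_iff {B : Type*} {δ : ℝ} {Z : Set B} {d : B → B → ℝ}
    (hd : ∀ z ∈ Z, d z z < δ) : cov δ Z d = 0 ↔ Z = ∅ := by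
  constructor
  · intro h
    obtain ⟨F, hF, hc, he⟩ := exists_encard_eq_cov hd
    rw [h, Set.encard_eq_zero] at he
    subst he
    refine Set.eq_empty_of_forall_notMem fun z hz => ?_
    obtain ⟨y, hy, -⟩ := hc z hz
    exact hy
  · rintro rfl
    have := cov_le_encard (δ := δ) (d := d) (Set.empty_subset (∅ : Set B)) (by simp)
    simpa using this

/-! ### The Hamming average -/

section Hamming
variable {A V : Type*} [MetricSpace A] [Fintype V]

theorem hammingAverage_self (x : V → A) : hammingAverage x x = 0 := by simp [hammingAverage]

theorem hammingAverage_comm (x y : V → A) : hammingAverage x y = hammingAverage y x := by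
  simp [hammingAverage, dist_comm]

theorem hammingAverage_triangle (x y z : V → A) :
    hammingAverage x z ≤ hammingAverage x y + hammingAverage y z := by
  rw [hammingAverage, hammingAverage, hammingAverage, ← add_div, ← Finset.sum_add_distrib]
  gcongr
  exact dist_triangle _ _ _

theorem hammingAverage_le_of_common {x y z : V → A} {a b : ℝ} (h₁ : hammingAverage x z < a)
    (h₂ : hammingAverage y z < b) : hammingAverage x y < a + b := by
  have := hammingAverage_triangle x z y
  rw [hammingAverage_comm z y] at this
  linarith

end Hamming

/-! ### Model rates -/

section Rate
variable {G : Type*} [Group G] (S : SoficApproximation G)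

theorem card_pos_ereal (n : ℕ) : (0 : EReal) < ((Fintype.card (S.V n) : ℕ) : EReal) := by
  exact_mod_cast Fintype.card_pos

theorem natCast_ne_top_ereal (n : ℕ) : ((n : ℕ) : EReal) ≠ ⊤ := EReal.natCast_ne_top n

variable {S} {A A' A'' : Type*} [MeasurableSpace A] [MetricSpace A] [MeasurableSpace A']
  [MetricSpace A'] [MeasurableSpace A''] [MetricSpace A'']
  {δ δ' δ'' : ℝ} {O : Set (ProbabilityMeasure (G → A))} {O' : Set (ProbabilityMeasure (G → A'))}
  {O'' : Set (ProbabilityMeasure (G → A''))} {n : ℕ}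

theorem modelRate_le_modelRate
    (h : cov δ (goodModels O (S.σ n)) hammingAverage ≤
      cov δ' (goodModels O' (S.σ n)) hammingAverage) :
    modelRate S δ O n ≤ modelRate S δ' O' n := by
  refine EReal.div_le_div_right_of_nonneg (card_pos_ereal S n).le (ENNReal.log_le_log ?_)
  exact_mod_cast h

theorem modelRate_le_add
    (h : cov δ (goodModels O (S.σ n)) hammingAverage ≤
      cov δ' (goodModels O' (S.σ n)) hammingAverage *
        cov δ'' (goodModels O'' (S.σ n)) hammingAverage) :
    modelRate S δ O n ≤ modelRate S δ' O' n + modelRate S δ'' O'' n := by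
  unfold modelRate
  rw [← EReal.add_div_of_nonneg_right (card_pos_ereal S n).le, ← ENNReal.log_mul_add]
  refine EReal.div_le_div_right_of_nonneg (card_pos_ereal S n).le (ENNReal.log_le_log ?_)
  exact_mod_cast h

theorem coe_mul_natCast (c : ℝ) (N : ℕ) : (c : EReal) * (N : EReal) = ((c * N : ℝ) : EReal) := by
  push_cast; rfl

/-- Turns exponential rates into inequalities between cardinalities, the form in which all counting
is done. -/
theorem coe_le_modelRate_iff (c : ℝ) : (c : EReal) ≤ modelRate S δ O n ↔
    ENNReal.ofReal (Real.exp (c * Fintype.card (S.V n))) ≤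
      ((cov δ (goodModels O (S.σ n)) hammingAverage : ℕ∞) : ENNReal) := by
  unfold modelRate
  rw [EReal.le_div_iff_mul_le (card_pos_ereal S n) (natCast_ne_top_ereal _), coe_mul_natCast,
    ← ENNReal.log_le_log_iff, ENNReal.log_ofReal_of_pos (Real.exp_pos _), Real.log_exp]

theorem modelRate_le_coe_iff (c : ℝ) : modelRate S δ O n ≤ (c : EReal) ↔
    ((cov δ (goodModels O (S.σ n)) hammingAverage : ℕ∞) : ENNReal) ≤
    ENNReal.ofReal (Real.exp (c * Fintype.card (S.V n))) := by
  unfold modelRate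
  rw [EReal.div_le_iff_le_mul (card_pos_ereal S n) (natCast_ne_top_ereal _), mul_comm,
    coe_mul_natCast,
    ← ENNReal.log_le_log_iff, ENNReal.log_ofReal_of_pos (Real.exp_pos _), Real.log_exp]

/-- A nonzero covering number is at least 1, so its logarithm is nonnegative. This is the source of
the dichotomy "`-∞` or `≥ 0`" for all the entropies. -/
theorem modelRate_nonneg_iff (hδ : 0 < δ) :
    0 ≤ modelRate S δ O n ↔ (goodModels O (S.σ n)).Nonempty := by
  have := coe_le_modelRate_iff (S := S) (δ := δ) (O := O) (n := n) 0
  rw [EReal.coe_zero] at this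
  rw [this, zero_mul, Real.exp_zero, ENNReal.ofReal_one, Set.nonempty_iff_ne_empty, ne_eq,
    ← cov_eq_zero_iff (δ := δ) (d := hammingAverage) (fun z _ => by rwa [hammingAverage_self]),
    ← ne_eq, ← Order.one_le_iff_ne_zero]
  exact_mod_cast Iff.rfl

theorem modelRate_eq_bot (hδ : 0 < δ) (h : ¬ (goodModels O (S.σ n)).Nonempty) :
    modelRate S δ O n = ⊥ := by
  have : cov δ (goodModels O (S.σ n)) hammingAverage = 0 := by
    rw [cov_eq_zero_iff fun z _ => by rwa [hammingAverage_self]]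
    exact Set.not_nonempty_iff_eq_empty.1 h
  rw [modelRate, this]
  simp only [ENat.toENNReal_zero, ENNReal.log_zero]
  exact EReal.bot_div_of_pos_ne_top (card_pos_ereal S n) (natCast_ne_top_ereal _)

variable (A) in
/-- On a compact space the model rates at a fixed scale are uniformly bounded. -/
theorem exists_modelRate_le [CompactSpace A] (S : SoficApproximation G) (hδ : 0 < δ) :
    ∃ C : ℝ, ∀ (O : Set (ProbabilityMeasure (G → A))) n, modelRate S δ O n ≤ C := by
  obtain ⟨t, -, ht, hcov⟩ := (isCompact_univ (X := A)).finite_cover_balls (e := δ / 2) (by linarith)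
  have hlab : ∀ a : A, ∃ c ∈ t, dist a c < δ / 2 := fun a => by
    have := hcov (Set.mem_univ a); simpa using this
  choose c hct hc using hlab
  refine ⟨Real.log (t.ncard), fun O n => ?_⟩
  rw [modelRate_le_coe_iff]
  let T : Set (S.V n → A) := Set.pi Set.univ fun _ => t
  have h1 : cov δ (goodModels O (S.σ n)) hammingAverage ≤ T.encard := by
    refine cov_le_of_label (fun x v => c (x v)) (fun x _ v _ => hct _) fun x _ y _ he => ?_
    rw [hammingAverage, div_lt_iff₀ (by exact_mod_cast Fintype.card_pos), mul_comm]
    have : ∑ v : S.V n, δ = Fintype.card (S.V n) * δ := by simp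
    rw [← this]
    refine Finset.sum_lt_sum_of_nonempty Finset.univ_nonempty fun v _ => ?_
    have h1 := hc (x v)
    have h2 := hc (y v)
    have h3 : c (x v) = c (y v) := congrFun he v
    rw [← h3] at h2
    have := dist_triangle_right (x v) (y v) (c (x v))
    linarith
  have hT : T.encard = ((t.ncard ^ Fintype.card (S.V n) : ℕ) : ℕ∞) := by
    have hf : T.Finite := Set.Finite.pi fun _ => ht
    rw [← hf.cast_ncard_eq, ← Nat.card_coe_set_eq, ← Nat.card_coe_set_eq]
    rw [Nat.card_congr (Equiv.Set.univPi fun _ : S.V n => t), Nat.card_pi]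
    simp
  refine le_trans (ENat.toENNReal_le.2 h1) ?_
  rw [hT]
  -- If `A` is empty the net may be empty too. Then `Real.log 0 = 0`, and the bound reads `0 ≤ 1`.
  have hpos : (0 : ℝ) < t.ncard ∨ t.ncard = 0 := by
    rcases Nat.eq_zero_or_pos t.ncard with h | h
    · exact .inr h
    · exact .inl (by exact_mod_cast h)
  rcases hpos with h | h
  · rw [mul_comm, Real.exp_nat_mul, Real.exp_log h]
    rw [← Nat.cast_pow, ENNReal.ofReal_natCast]
    simp
  · rw [h]; simp [Fintype.card_ne_zero]

end Rate

/-! ### Empirical distributions -/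

section Empirical
variable {G A A' V : Type*} [MeasurableSpace A] [MeasurableSpace A'] [Fintype V] [Nonempty V]

theorem integral_empirical [MeasurableSingletonClass (G → A)] (σ : G → Equiv.Perm V) (x : V → A)
    (f : (G → A) → ℝ) :
    ∫ ω, f ω ∂(empirical σ x : Measure (G → A)) =
      (∑ v, f (pullbackName σ x v)) / Fintype.card V := by
  change ∫ ω, f ω ∂((Fintype.card V : ENNReal)⁻¹ • ∑ v : V, Measure.dirac (pullbackName σ x v)) = _
  rw [integral_smul_measure, integral_finsetSum_measure]
  · simp [div_eq_inv_mul]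
  · intro v _
    exact integrable_dirac (by simp)

/-- Empirical distributions commute with letterwise maps, so good joint models project to good
models of the marginals. -/
theorem empirical_map (σ : G → Equiv.Perm V) (x : V → A) {p : A → A'}
    (hm : Measurable fun (ω : G → A) g => p (ω g)) :
    (empirical σ x).map hm.aemeasurable = empirical σ fun v => p (x v) := by
  apply Subtype.ext
  ext s hs
  change Measure.map _ ((Fintype.card V : ENNReal)⁻¹ • ∑ v : V, Measure.dirac _) s =
    ((Fintype.card V : ENNReal)⁻¹ • ∑ v : V, Measure.dirac _) s
  rw [Measure.map_apply hm hs]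
  simp only [Measure.smul_apply, Measure.finsetSum_apply]
  congr 1
  refine Finset.sum_congr rfl fun v _ => ?_
  rw [Measure.dirac_apply' _ (hm hs), Measure.dirac_apply' _ hs]
  rfl

end Empirical

/-- The average over `V` is invariant under permutations. -/
theorem hammingAverage_comp_perm {A V : Type*} [Fintype V] [MetricSpace A] (x y : V → A) (s : Equiv.Perm V) :
    (∑ v, dist (x (s v)) (y (s v))) / Fintype.card V = hammingAverage x y := by
  rw [hammingAverage, Equiv.sum_comp s fun v => dist (x v) (y v)]


/-! ### Topological preliminaries -/

/-- In a compact space, finitely many members of a family of closed sets with a single common point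
have their intersection inside a given neighbourhood of it. -/
theorem exists_finset_biInter_subset {X ι : Type*} [TopologicalSpace X] [CompactSpace X] {p : X}
    {O : Set X} (hO : O ∈ 𝓝 p) (C : ι → Set X) (hC : ∀ i, IsClosed (C i))
    (h : ∀ x, (∀ i, x ∈ C i) → x = p) :
    ∃ u : Finset ι, ∀ x, (∀ i ∈ u, x ∈ C i) → x ∈ O := by
  have hc : IsCompact (interior O)ᶜ := isOpen_interior.isClosed_compl.isCompact
  obtain ⟨u, hu⟩ := hc.elim_finite_subfamily_closed C hC (by
    refine Set.eq_empty_of_forall_notMem fun x hx => ?_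
    have := h x fun i => Set.mem_iInter.1 hx.2 i
    subst this
    exact hx.1 (mem_interior_iff_mem_nhds.2 hO))
  refine ⟨u, fun x hx => interior_subset ?_⟩
  by_contra hxO
  have : x ∈ (interior O)ᶜ ∩ ⋂ i ∈ u, C i := ⟨hxO, by simpa using hx⟩
  rw [hu] at this
  exact this

/-- A continuous function on a compact product depends approximately on finitely many
coordinates. -/
theorem exists_finset_forall_dist_lt {G K E : Type*} [MetricSpace K] [CompactSpace K]
    [PseudoMetricSpace E] {W : (G → K) → E} (hW : Continuous W) {ε : ℝ} (hε : 0 < ε) :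
    ∃ (F : Finset G) (η : ℝ), 0 < η ∧ ∀ ω ω' : G → K, (∀ h ∈ F, dist (ω h) (ω' h) < η) →
      dist (W ω) (W ω') < ε := by
  have hu := CompactSpace.uniformContinuous_of_continuous hW
  have h1 : {p : (G → K) × (G → K) | dist (W p.1) (W p.2) < ε} ∈ uniformity (G → K) :=
    hu (Metric.dist_mem_uniformity hε)
  rw [Pi.uniformity, Filter.mem_iInf'] at h1
  obtain ⟨I, hI, V, hV, -, hVe, -⟩ := h1
  have h2 : ∀ i, ∃ η > 0, ∀ ω ω' : G → K, dist (ω i) (ω' i) < η → (ω, ω') ∈ V i := fun i => by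
    obtain ⟨U, hU, hUV⟩ := Filter.mem_comap.1 (hV i)
    obtain ⟨η, hη, hηU⟩ := Metric.mem_uniformity_dist.1 hU
    exact ⟨η, hη, fun ω ω' hd => hUV (hηU hd)⟩
  choose η hη hηV using h2
  obtain ⟨η₀, hη₀, hle⟩ : ∃ η₀ > 0, ∀ i ∈ I, η₀ ≤ η i := by
    rcases I.eq_empty_or_nonempty with h | h
    · exact ⟨1, one_pos, by simp [h]⟩
    · obtain ⟨i, hi, hmin⟩ := hI.exists_minimalFor η I h
      refine ⟨η i, hη i, fun j hj => ?_⟩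
      by_contra hlt
      push Not at hlt
      exact absurd (hmin hj hlt.le) (not_le.2 hlt)
  refine ⟨hI.toFinset, η₀, hη₀, fun ω ω' hd => ?_⟩
  have : (ω, ω') ∈ ⋂ i ∈ I, V i := by
    simp only [Set.mem_iInter]
    exact fun i hi => hηV i _ _ ((hd i (by simpa using hi)).trans_le (hle i hi))
  rw [← hVe] at this
  exact this

/-- The ambient Banach space of the Kuratowski embedding. -/
abbrev KSpace : Type := lp (fun _ : ℕ => ℝ) ⊤

/-- Measurable functions into a compact metric space are approximated in mean by continuous functions
into the ambient Banach space. -/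
theorem exists_continuous_approx {Ω K : Type*} [TopologicalSpace Ω] [CompactSpace Ω]
    [NormalSpace Ω] [MeasurableSpace Ω] [BorelSpace Ω] [MetricSpace K] [CompactSpace K]
    [MeasurableSpace K] [BorelSpace K] (m : Measure Ω) [IsProbabilityMeasure m] [m.WeaklyRegular]
    {f : Ω → K} (hf : Measurable f) {ε : ℝ} (hε : 0 < ε) :
    ∃ W : Ω → KSpace, Continuous W ∧ ∫ ω, ‖kuratowskiEmbedding K (f ω) - W ω‖ ∂m ≤ ε ∧
      Integrable (fun ω => ‖kuratowskiEmbedding K (f ω) - W ω‖) m := by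
  -- Continuous maps into `K` itself would not suffice: from a connected `Ω` to a totally
  -- disconnected `K` they are all constant. In the Banach space, density of bounded continuous
  -- functions in `L¹` applies.
  have hι := (kuratowskiEmbedding.isometry K).continuous
  obtain ⟨C, hC⟩ := (isCompact_range hι).isBounded.exists_norm_le
  have hint : Integrable (fun ω => kuratowskiEmbedding K (f ω)) m := by
    refine Integrable.of_bound (C := C)
      (hι.comp_stronglyMeasurable hf.stronglyMeasurable).aestronglyMeasurable ?_
    exact Eventually.of_forall fun ω => hC _ ⟨_, rfl⟩
  obtain ⟨W, hW, hWi⟩ := hint.exists_boundedContinuous_integral_sub_le hε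
  exact ⟨W, W.continuous, hW, (hint.sub hWi).norm⟩

/-! ### Names -/

section Names
variable {G L K Z : Type*} [Group G]

/-- The shift by `g`. -/
def shiftName (g : G) (ω : G → L) : G → L := fun h => ω (h * g)

theorem continuous_shiftName [TopologicalSpace L] (g : G) :
    Continuous (shiftName g : (G → L) → G → L) :=
  continuous_pi fun h => continuous_apply (h * g)

theorem measurable_shiftName [MeasurableSpace L] (g : G) :
    Measurable (shiftName g : (G → L) → G → L) :=
  measurable_pi_lambda _ fun h => measurable_pi_apply (h * g)

/-- The name of a point along its orbit. -/
def orbitName (G : Type*) {L Z : Type*} [SMul G Z] (ψ : Z → L) (x : Z) : G → L :=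
  fun h => ψ (h • x)

theorem orbitName_smul [MulAction G Z] (ψ : Z → L) (g : G) (x : Z) :
    orbitName G ψ (g • x) = shiftName g (orbitName G ψ x) := by
  funext h; simp [orbitName, shiftName, mul_smul]

theorem measurable_orbitName [MulAction G Z] [MeasurableSpace Z] [MeasurableConstSMul G Z]
    [MeasurableSpace L] {ψ : Z → L} (hψ : Measurable ψ) : Measurable (orbitName G ψ) :=
  measurable_pi_lambda _ fun h => hψ.comp (measurable_const_smul h)

/-- The law of the names. -/
def obsLaw (G : Type*) {L Z : Type*} [Group G] [MulAction G Z] [MeasurableSpace Z]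
    [MeasurableConstSMul G Z] [MeasurableSpace L] (μ : Measure Z) [IsProbabilityMeasure μ]
    {ψ : Z → L} (hψ : Measurable ψ) : ProbabilityMeasure (G → L) :=
  ⟨μ.map (orbitName G ψ), Measure.isProbabilityMeasure_map (measurable_orbitName hψ).aemeasurable⟩

/-- The observable `ψ` determines `φ`: almost surely `φ` is a measurable function of the `ψ`-name. -/
def Determines (G : Type*) {L K Z : Type*} [Group G] [MulAction G Z] [MeasurableSpace Z]
    [MeasurableSpace L] [MeasurableSpace K] (μ : Measure Z) (ψ : Z → L) (φ : Z → K) : Prop :=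
  ∃ f : (G → L) → K, Measurable f ∧ ∀ᵐ x ∂μ, φ x = f (orbitName G ψ x)

end Names

/-! ### Uniform estimates for pullback names -/

section Estimates
variable {G L : Type*} [Group G] [MetricSpace L] [CompactSpace L]

theorem tendsto_card_not_mul (S : SoficApproximation G) (g h : G) [∀ n, DecidableEq (S.V n)] :
    Tendsto (fun n => (∑ v : S.V n, if S.σ n g (S.σ n h v) = S.σ n (g * h) v then (0 : ℝ) else 1) /
      Fintype.card (S.V n)) atTop (𝓝 0) := by
  have h1 := (S.asymp_mul g h).const_sub 1
  rw [sub_self] at h1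
  refine h1.congr fun n => ?_
  have hN : (Fintype.card (S.V n) : ℝ) ≠ 0 := by exact_mod_cast Fintype.card_ne_zero
  rw [proportion, eq_div_iff hN, sub_mul, div_mul_cancel₀ _ hN, one_mul, Nat.card_eq_fintype_card,
    Fintype.card_subtype, sub_eq_iff_eq_add, Finset.card_filter, Nat.cast_sum,
    ← Finset.sum_add_distrib]
  have : ∀ v ∈ (Finset.univ : Finset (S.V n)),
      ((if S.σ n g (S.σ n h v) = S.σ n (g * h) v then (0 : ℝ) else 1) +
        ((if S.σ n g (S.σ n h v) = S.σ n (g * h) v then 1 else 0 : ℕ) : ℝ)) = 1 := by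
    intro v _; split_ifs <;> simp
  rw [Finset.sum_congr rfl this]; simp

/-- For most `v` the name at `σ g v` is nearly the shift of the name at `v`, uniformly over all
models. -/
theorem eventually_average_shift_le (S : SoficApproximation G) {W : (G → L) → KSpace}
    (hW : Continuous W) (g : G) {ε : ℝ} (hε : 0 < ε) :
    ∀ᶠ n in atTop, ∀ y : S.V n → L,
      (∑ v, ‖W (pullbackName (S.σ n) y (S.σ n g v)) -
        W (shiftName g (pullbackName (S.σ n) y v))‖) / Fintype.card (S.V n) ≤ ε := by
  classical
  obtain ⟨F, η, hη, hF⟩ := exists_finset_forall_dist_lt hW (half_pos hε)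
  obtain ⟨B, hB⟩ := (isCompact_range hW).isBounded.exists_norm_le
  have hB' : ∀ ω, ‖W ω‖ ≤ B := fun ω => hB _ ⟨ω, rfl⟩
  have key : Tendsto (fun n => 2 * B * ∑ h ∈ F,
      (∑ v : S.V n, if S.σ n h (S.σ n g v) = S.σ n (h * g) v then (0 : ℝ) else 1) /
        Fintype.card (S.V n)) atTop (𝓝 0) := by
    have := (tendsto_finsetSum F fun h _ => tendsto_card_not_mul S h g).const_mul (2 * B)
    simpa using this
  filter_upwards [key.eventually (gt_mem_nhds (half_pos hε))] with n hn y
  have hB0 : 0 ≤ B := (norm_nonneg _).trans (hB' (fun h => y (S.σ n h (Classical.arbitrary _))))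
  have hN : (0 : ℝ) < Fintype.card (S.V n) := by exact_mod_cast Fintype.card_pos
  -- Where multiplicativity holds for every `h` in the window `F`, the two names agree on `F`. At
  -- any other place the crude bound `2B` is paid by some `h ∈ F` that fails there.
  have pt : ∀ v : S.V n, ‖W (pullbackName (S.σ n) y (S.σ n g v)) -
      W (shiftName g (pullbackName (S.σ n) y v))‖ ≤ ε / 2 +
        2 * B * ∑ h ∈ F, if S.σ n h (S.σ n g v) = S.σ n (h * g) v then (0 : ℝ) else 1 := by
    intro v
    by_cases hv : ∀ h ∈ F, S.σ n h (S.σ n g v) = S.σ n (h * g) v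
    · have h1 := hF (pullbackName (S.σ n) y (S.σ n g v)) (shiftName g (pullbackName (S.σ n) y v))
        fun h hh => by simp [pullbackName, shiftName, hv h hh, hη]
      rw [dist_eq_norm] at h1
      refine h1.le.trans (le_add_of_nonneg_right ?_)
      exact mul_nonneg (by linarith) (Finset.sum_nonneg fun h _ => by split_ifs <;> simp)
    · push Not at hv
      obtain ⟨h, hh, hne⟩ := hv
      have h1 : (1 : ℝ) ≤ ∑ h ∈ F, if S.σ n h (S.σ n g v) = S.σ n (h * g) v then (0 : ℝ) else 1 := by
        refine le_trans ?_ (Finset.single_le_sum (f := fun h =>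
          if S.σ n h (S.σ n g v) = S.σ n (h * g) v then (0 : ℝ) else 1) (fun h _ => by
          split_ifs <;> simp) hh)
        simp [hne]
      have h2 := norm_sub_le (W (pullbackName (S.σ n) y (S.σ n g v)))
        (W (shiftName g (pullbackName (S.σ n) y v)))
      nlinarith [hB' (pullbackName (S.σ n) y (S.σ n g v)),
        hB' (shiftName g (pullbackName (S.σ n) y v))]
  rw [div_le_iff₀ hN]
  refine (Finset.sum_le_sum fun v _ => pt v).trans ?_
  rw [Finset.sum_add_distrib, ← Finset.mul_sum, Finset.sum_comm]
  rw [← Finset.sum_div, ← mul_div_assoc, div_lt_iff₀ hN] at hn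
  simp only [Finset.sum_const, Finset.card_univ, nsmul_eq_mul]
  nlinarith

end Estimates

/-- Models which are close in the Hamming average have close names at most places. -/
theorem exists_average_norm_sub_le {G K : Type*} [MetricSpace K] [CompactSpace K]
    {W : (G → K) → KSpace} (hW : Continuous W) {ε : ℝ} (hε : 0 < ε) :
    ∃ C : ℝ, 0 ≤ C ∧ ∀ {V : Type} [Fintype V] [Nonempty V] (σ : G → Equiv.Perm V) (x x' : V → K),
      (∑ v, ‖W (pullbackName σ x v) - W (pullbackName σ x' v)‖) / Fintype.card V ≤
        ε + C * hammingAverage x x' := by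
  obtain ⟨F, η, hη, hF⟩ := exists_finset_forall_dist_lt hW hε
  obtain ⟨B, hB⟩ := (isCompact_range hW).isBounded.exists_norm_le
  have hB' : ∀ ω, ‖W ω‖ ≤ |B| := fun ω => (hB _ ⟨ω, rfl⟩).trans (le_abs_self B)
  refine ⟨2 * |B| / η * F.card, by positivity, fun {V} _ _ σ x x' => ?_⟩
  have hN : (0 : ℝ) < Fintype.card V := by exact_mod_cast Fintype.card_pos
  -- Either the names are `η`-close on the window `F`, or the sum over `F` is at least `η` and pays
  -- for the crude bound `2|B|`.
  have pt : ∀ v, ‖W (pullbackName σ x v) - W (pullbackName σ x' v)‖ ≤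
      ε + 2 * |B| / η * ∑ h ∈ F, dist (x (σ h v)) (x' (σ h v)) := by
    intro v
    by_cases hv : ∀ h ∈ F, dist (x (σ h v)) (x' (σ h v)) < η
    · have h1 := hF (pullbackName σ x v) (pullbackName σ x' v) hv
      rw [dist_eq_norm] at h1
      exact h1.le.trans (le_add_of_nonneg_right (by positivity))
    · push Not at hv
      obtain ⟨h, hh, hge⟩ := hv
      have h1 : η ≤ ∑ h ∈ F, dist (x (σ h v)) (x' (σ h v)) := hge.trans
        (Finset.single_le_sum (f := fun h => dist (x (σ h v)) (x' (σ h v)))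
          (fun _ _ => dist_nonneg) hh)
      have h2 := norm_sub_le (W (pullbackName σ x v)) (W (pullbackName σ x' v))
      have h3 : 2 * |B| / η * η ≤ 2 * |B| / η * ∑ h ∈ F, dist (x (σ h v)) (x' (σ h v)) := by gcongr
      rw [div_mul_cancel₀ _ hη.ne'] at h3
      linarith [hB' (pullbackName σ x v), hB' (pullbackName σ x' v)]
  have hs : ∑ v, ∑ h ∈ F, dist (x (σ h v)) (x' (σ h v)) =
      F.card * (hammingAverage x x' * Fintype.card V) := by
    rw [Finset.sum_comm]
    have : ∀ h ∈ F, ∑ v, dist (x (σ h v)) (x' (σ h v)) = hammingAverage x x' * Fintype.card V :=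
      fun h _ => by rw [← hammingAverage_comp_perm x x' (σ h), div_mul_cancel₀ _ hN.ne']
    rw [Finset.sum_congr rfl this]; simp
  rw [div_le_iff₀ hN]
  refine (Finset.sum_le_sum fun v _ => pt v).trans ?_
  rw [Finset.sum_add_distrib, ← Finset.mul_sum, hs]
  simp only [Finset.sum_const, Finset.card_univ, nsmul_eq_mul]
  linarith

/-! ### Equivariant codes: lifting models and separating them. -/

theorem integrable_of_continuous {Ω E : Type*} [TopologicalSpace Ω] [CompactSpace Ω]
    [MeasurableSpace Ω] [OpensMeasurableSpace Ω] [NormedAddCommGroup E]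
    (m : Measure Ω) [IsFiniteMeasure m] {W : Ω → E} (hW : Continuous W)
    [SecondCountableTopologyEither Ω E] : Integrable W m := by
  obtain ⟨B, hB⟩ := (isCompact_range hW).isBounded.exists_norm_le
  exact Integrable.of_bound hW.aestronglyMeasurable B (Eventually.of_forall fun ω => hB _ ⟨ω, rfl⟩)

theorem stronglyMeasurable_kuratowski {Ω K : Type*} [MeasurableSpace Ω] [MetricSpace K]
    [CompactSpace K] [MeasurableSpace K] [BorelSpace K] {f : Ω → K} (hf : Measurable f) :
    StronglyMeasurable fun ω => kuratowskiEmbedding K (f ω) :=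
  (kuratowskiEmbedding.isometry K).continuous.comp_stronglyMeasurable hf.stronglyMeasurable

theorem integrable_kuratowski {Ω K : Type*} [MeasurableSpace Ω] [MetricSpace K] [CompactSpace K]
    [MeasurableSpace K] [BorelSpace K] (m : Measure Ω) [IsFiniteMeasure m] {f : Ω → K}
    (hf : Measurable f) : Integrable (fun ω => kuratowskiEmbedding K (f ω)) m := by
  have hι := (kuratowskiEmbedding.isometry K).continuous
  obtain ⟨C, hC⟩ := (isCompact_range hι).isBounded.exists_norm_le
  exact Integrable.of_bound (stronglyMeasurable_kuratowski hf).aestronglyMeasurable C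
    (Eventually.of_forall fun ω => hC _ ⟨_, rfl⟩)

/-- The joint name of a name and its image under the equivariant code with local rule `f`. -/
def codeGraph {G L K : Type*} [Group G] (f : (G → L) → K) (ω : G → L) : G → L × K :=
  fun g => (ω g, f (shiftName g ω))

theorem measurable_codeGraph {G L K : Type*} [Group G] [MeasurableSpace L] [MeasurableSpace K]
    {f : (G → L) → K} (hf : Measurable f) : Measurable (codeGraph f) :=
  measurable_pi_lambda _ fun g =>
    (measurable_pi_apply g).prodMk (hf.comp (measurable_shiftName g))

section Lift
variable {G L K : Type*} [Group G] [Countable G]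
  [MetricSpace L] [CompactSpace L] [MeasurableSpace L] [BorelSpace L]
  [MetricSpace K] [CompactSpace K] [MeasurableSpace K] [BorelSpace K]

/-- A joint law with first marginal `m` whose second coordinates are approximated by the images of
the first ones under approximations to `f` is the law of the graph of the code. -/
theorem eq_map_codeGraph (m : Measure (G → L)) [IsProbabilityMeasure m]
    (hinv : ∀ g, m.map (shiftName g) = m) {f : (G → L) → K} (hf : Measurable f)
    (W : ℕ → (G → L) → KSpace) (hWc : ∀ i, Continuous (W i))
    (hW : ∀ i : ℕ, ∫ ω, ‖kuratowskiEmbedding K (f ω) - W i ω‖ ∂m ≤ 1 / (i + 1))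
    (ρ : Measure (G → L × K)) [IsProbabilityMeasure ρ]
    (h1 : ρ.map (fun ω g => (ω g).1) = m)
    (h2 : ∀ (i : ℕ) (g : G), ∫ ω, ‖kuratowskiEmbedding K (ω g).2 -
      W i (shiftName g fun h => (ω h).1)‖ ∂ρ ≤ 4 * (1 / (i + 1))) :
    ρ = m.map (codeGraph f) := by
  have hfst : Measurable fun (ω : G → L × K) g => (ω g).1 :=
    measurable_pi_lambda _ fun g => (measurable_pi_apply g).fst
  have i1 : ∀ g, Integrable (fun ω : G → L × K => kuratowskiEmbedding K (ω g).2) ρ := fun g =>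
    integrable_kuratowski ρ (measurable_pi_apply g).snd
  have i2 : ∀ g, Integrable (fun ω : G → L × K =>
      kuratowskiEmbedding K (f (shiftName g fun h => (ω h).1))) ρ := fun g =>
    integrable_kuratowski ρ (hf.comp ((measurable_shiftName g).comp hfst))
  have i3 : ∀ i g, Integrable (fun ω : G → L × K => W i (shiftName g fun h => (ω h).1)) ρ :=
    fun i g => integrable_of_continuous ρ
      ((hWc i).comp ((continuous_shiftName g).comp (by fun_prop)))
  -- Shift invariance of `m` carries the estimate at the identity to every `g`.
  have h3 : ∀ (i : ℕ) (g : G), ∫ ω, ‖kuratowskiEmbedding K (f (shiftName g fun h => (ω h).1)) -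
      W i (shiftName g fun h => (ω h).1)‖ ∂ρ ≤ 1 / (i + 1) := fun i g => by
    refine le_of_eq_of_le ?_ (hW i)
    have hs : StronglyMeasurable fun ω => ‖kuratowskiEmbedding K (f ω) - W i ω‖ :=
      ((stronglyMeasurable_kuratowski hf).sub (hWc i).stronglyMeasurable).norm
    conv_rhs => rw [← hinv g, ← h1]
    rw [integral_map (measurable_shiftName g).aemeasurable hs.aestronglyMeasurable]
    exact (integral_map hfst.aemeasurable
        (hs.comp_measurable (measurable_shiftName g)).aestronglyMeasurable).symm
  have key : ∀ g, ∀ᵐ ω ∂ρ, (ω g).2 = f (shiftName g fun h => (ω h).1) := by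
    intro g
    have h0 : ∫ ω, ‖kuratowskiEmbedding K (ω g).2 -
        kuratowskiEmbedding K (f (shiftName g fun h => (ω h).1))‖ ∂ρ = 0 := by
      refine le_antisymm ?_ (integral_nonneg fun _ => norm_nonneg _)
      -- Here 5 is the 4 of `h2` plus the 1 of `h3`.
      have hlim : Tendsto (fun i : ℕ => 5 * (1 / ((i : ℝ) + 1))) atTop (𝓝 (5 * 0)) :=
        tendsto_one_div_add_atTop_nhds_zero_nat.const_mul 5
      rw [mul_zero] at hlim
      refine ge_of_tendsto' hlim fun i => ?_
      calc _ ≤ ∫ ω, (‖kuratowskiEmbedding K (ω g).2 - W i (shiftName g fun h => (ω h).1)‖ +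
            ‖kuratowskiEmbedding K (f (shiftName g fun h => (ω h).1)) -
              W i (shiftName g fun h => (ω h).1)‖) ∂ρ := by
            refine integral_mono ((i1 g).sub (i2 g)).norm
              (((i1 g).sub (i3 i g)).norm.add ((i2 g).sub (i3 i g)).norm) fun ω => ?_
            have := norm_sub_le (kuratowskiEmbedding K (ω g).2 - W i (shiftName g fun h => (ω h).1))
              (kuratowskiEmbedding K (f (shiftName g fun h => (ω h).1)) -
              W i (shiftName g fun h => (ω h).1))
            simpa using this
        _ ≤ _ := by
            have e1 := integral_add ((i1 g).sub (i3 i g)).norm ((i2 g).sub (i3 i g)).norm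
            simp only [Pi.sub_apply] at e1
            rw [e1]
            linarith [h2 i g, h3 i g]
    rw [integral_eq_zero_iff_of_nonneg (fun _ => norm_nonneg _)
      (((i1 g).sub (i2 g)).norm.congr (by rfl))] at h0
    filter_upwards [h0] with ω hω
    simp only [Pi.zero_apply, norm_eq_zero, sub_eq_zero] at hω
    exact (kuratowskiEmbedding.isometry K).injective hω
  have hae : ∀ᵐ ω ∂ρ, ω = codeGraph f (fun h => (ω h).1) := by
    filter_upwards [ae_all_iff.2 key] with ω hω
    funext g
    exact Prod.ext rfl (hω g)
  calc ρ = ρ.map id := Measure.map_id.symm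
    _ = ρ.map (codeGraph f ∘ fun ω h => (ω h).1) := Measure.map_congr hae
    _ = (ρ.map fun ω h => (ω h).1).map (codeGraph f) :=
      (Measure.map_map (measurable_codeGraph hf) hfst).symm
    _ = _ := by rw [h1]

/-- Good models for a process lift to good models for the joint process with a coded process. -/
theorem exists_lift_goodModels (S : SoficApproximation G) (m : ProbabilityMeasure (G → L))
    (hinv : ∀ g, (m : Measure (G → L)).map (shiftName g) = m) {f : (G → L) → K} (hf : Measurable f)
    (Λ : ProbabilityMeasure (G → L × K)) (hΛ : (Λ : Measure _) = (m : Measure _).map (codeGraph f))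
    {O' : Set (ProbabilityMeasure (G → L × K))} (hO' : O' ∈ 𝓝 Λ) :
    ∃ O ∈ 𝓝 m, ∀ᶠ n in atTop, ∀ y ∈ goodModels O (S.σ n), ∃ x : S.V n → K,
      (fun v => (y v, x v)) ∈ goodModels O' (S.σ n) := by
  have hexW : ∀ i : ℕ, ∃ W : (G → L) → KSpace, Continuous W ∧
      ∫ ω, ‖kuratowskiEmbedding K (f ω) - W ω‖ ∂(m : Measure _) ≤ 1 / (i + 1) ∧
      Integrable (fun ω => ‖kuratowskiEmbedding K (f ω) - W ω‖) (m : Measure _) := fun i =>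
    exists_continuous_approx _ hf (by positivity)
  choose W hWc hW hWi using hexW
  have hKne : Nonempty K := ⟨f m.nonempty.some⟩
  have hfst : Measurable fun (ω : G → L × K) g => (ω g).1 :=
    measurable_pi_lambda _ fun g => (measurable_pi_apply g).fst
  have hι := (kuratowskiEmbedding.isometry K).continuous
  have hcD : ∀ i g, Continuous fun ω : G → L × K => ‖kuratowskiEmbedding K (ω g).2 -
      W i (shiftName g fun h => (ω h).1)‖ := fun i g =>
    ((hι.comp (by fun_prop)).sub
      ((hWc i).comp ((continuous_shiftName g).comp (by fun_prop)))).norm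
  -- Closed conditions with `Λ` as the only common solution: the first kind fixes the first
  -- marginal, the second ties the second coordinates to the code. By compactness finitely many of
  -- them suffice. The factor 4 leaves room for the rounding error and the shift error.
  let C : C(G → L, ℝ) × ℕ ⊕ ℕ × G → Set (ProbabilityMeasure (G → L × K)) := fun j => match j with
    | .inl (h, i) => {ρ | |∫ ω, h (fun g => (ω g).1) ∂(ρ : Measure (G → L × K)) - ∫ ω, h ω ∂(m : Measure _)|
        ≤ 1 / (i + 1)}
    | .inr (i, g) => {ρ | ∫ ω, ‖kuratowskiEmbedding K (ω g).2 -
      W i (shiftName g fun h => (ω h).1)‖ ∂(ρ : Measure (G → L × K)) ≤ 4 * (1 / (i + 1))}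
  have hC : ∀ j, IsClosed (C j) := by
    rintro (⟨h, i⟩ | ⟨i, g⟩)
    · have := ProbabilityMeasure.continuous_integral_continuousMap
        (X := G → L × K) (⟨fun ω => h (fun g => (ω g).1), by fun_prop⟩ : C(G → L × K, ℝ))
      exact isClosed_le (this.sub continuous_const).abs continuous_const
    · have := ProbabilityMeasure.continuous_integral_continuousMap
        (X := G → L × K) (⟨_, hcD i g⟩ : C(G → L × K, ℝ))
      exact isClosed_le this continuous_const
  obtain ⟨u, hu⟩ := exists_finset_biInter_subset hO' C hC (by
    intro ρ hρ
    apply Subtype.ext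
    have h1 : (ρ : Measure (G → L × K)).map (fun ω g => (ω g).1) = m := by
      have : IsProbabilityMeasure ((ρ : Measure (G → L × K)).map (fun ω g => (ω g).1)) :=
        Measure.isProbabilityMeasure_map hfst.aemeasurable
      refine ext_of_forall_integral_eq_of_IsFiniteMeasure fun h => ?_
      rw [integral_map hfst.aemeasurable h.continuous.aestronglyMeasurable]
      have hlim : Tendsto (fun i : ℕ => 1 / ((i : ℝ) + 1)) atTop (𝓝 0) :=
        tendsto_one_div_add_atTop_nhds_zero_nat
      have := ge_of_tendsto' hlim fun i => hρ (.inl (h.toContinuousMap, i))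
      exact sub_eq_zero.1 (abs_eq_zero.1 (le_antisymm this (abs_nonneg _)))
    exact (eq_map_codeGraph m hinv hf W hWc hW ρ h1 fun i g => hρ (.inr (i, g))).trans hΛ.symm)
  -- the accuracy used for the rounding
  let M : ℕ := u.sup fun j => match j with
    | .inl _ => 0
    | .inr (i, _) => i
  have hM : ∀ i g, (.inr (i, g) : C(G → L, ℝ) × ℕ ⊕ ℕ × G) ∈ u → i ≤ M := fun i g h =>
    Finset.le_sup (f := fun j : C(G → L, ℝ) × ℕ ⊕ ℕ × G => match j with
    | .inl _ => 0
    | .inr (i, _) => i) h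
  let e : (G → L) → ℝ := fun ω => Metric.infDist (W M ω) (Set.range (kuratowskiEmbedding K))
  have hec : Continuous e := (Metric.continuous_infDist_pt _).comp (hWc M)
  -- A continuous bound for the distance from `W i ω` to the point of `K` nearest to `W M ω`.
  let q : ℕ → (G → L) → ℝ := fun i ω => e ω + ‖W M ω - W i ω‖
  have hq : ∀ i, Continuous (q i) := fun i => hec.add ((hWc M).sub (hWc i)).norm
  -- The 3 counts one error for `e` and two for passing from `W M` to `W i` through `f`.
  have hqint : ∀ i, i ≤ M → ∫ ω, q i ω ∂(m : Measure _) ≤ 3 * (1 / (i + 1)) := by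
    intro i hi
    have hle : 1 / ((M : ℝ) + 1) ≤ 1 / (i + 1) := by
      have : (i : ℝ) ≤ M := by exact_mod_cast hi
      gcongr
    calc _ ≤ ∫ ω, (‖kuratowskiEmbedding K (f ω) - W M ω‖ + (‖kuratowskiEmbedding K (f ω) - W M ω‖ +
          ‖kuratowskiEmbedding K (f ω) - W i ω‖)) ∂(m : Measure _) := by
          refine integral_mono (integrable_of_continuous _ (hq i))
            ((hWi M).add ((hWi M).add (hWi i))) fun ω => ?_
          refine add_le_add ?_ ?_
          · rw [← dist_eq_norm, dist_comm]
            exact Metric.infDist_le_dist_of_mem ⟨_, rfl⟩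
          · rw [norm_sub_rev (kuratowskiEmbedding K (f ω)) (W M ω)]
            exact norm_sub_le_norm_sub_add_norm_sub _ _ _
      _ ≤ _ := by
          have e1 := integral_add (hWi M) ((hWi M).add (hWi i))
          have e2 := integral_add (hWi M) (hWi i)
          simp only [Pi.add_apply] at e1
          rw [e1, e2]
          linarith [hW M, hW i]
  -- The constant `7/2` exceeds the 3 of `hqint`, so the condition is open around `m`, and it leaves
  -- `1/2` for the shift error.
  let D : C(G → L, ℝ) × ℕ ⊕ ℕ × G → Set (ProbabilityMeasure (G → L)) := fun j => match j with
    | .inl (h, i) => {ρ | |∫ ω, h ω ∂(ρ : Measure (G → L)) - ∫ ω, h ω ∂(m : Measure (G → L))| <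
        1 / ((i : ℝ) + 1)}
    | .inr (i, _) => {ρ | ∫ ω, q i ω ∂(ρ : Measure (G → L)) < 7 / 2 * (1 / ((i : ℝ) + 1))}
  refine ⟨⋂ j ∈ u, D j, ?_, ?_⟩
  · refine (Filter.biInter_finset_mem u).2 ?_
    rintro (⟨h, i⟩ | ⟨i, g⟩) hj
    · refine IsOpen.mem_nhds (isOpen_lt
        ((ProbabilityMeasure.continuous_integral_continuousMap h).sub continuous_const).abs
          continuous_const) ?_
      change |(_ : ℝ) - _| < _
      rw [sub_self, abs_zero]
      positivity
    · refine IsOpen.mem_nhds (isOpen_lt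
        (ProbabilityMeasure.continuous_integral_continuousMap (⟨_, hq i⟩ : C(G → L, ℝ)))
          continuous_const) ?_
      have := hqint i (hM i g hj)
      have hp : (0 : ℝ) < 1 / (i + 1) := by positivity
      change ∫ ω, q i ω ∂(m : Measure (G → L)) < _
      linarith
  · have hev : ∀ᶠ n in atTop, ∀ j ∈ u, ∀ i g, j = .inr (i, g) → ∀ y : S.V n → L,
        (∑ v, ‖W i (pullbackName (S.σ n) y (S.σ n g v)) -
          W i (shiftName g (pullbackName (S.σ n) y v))‖) / Fintype.card (S.V n) ≤
            1 / 2 * (1 / (i + 1)) := by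
      refine (Finset.eventually_all u).2 ?_
      rintro (⟨h, i⟩ | ⟨i, g⟩) hj
      · exact Eventually.of_forall fun n i g h => by simp at h
      · filter_upwards [eventually_average_shift_le S (hWc i) g
          (ε := 1 / 2 * (1 / (i + 1))) (by positivity)] with n hn i' g' he y
        simp only [Sum.inr.injEq, Prod.mk.injEq] at he
        obtain ⟨rfl, rfl⟩ := he
        exact hn y
    filter_upwards [hev] with n hn y hy
    -- Round `W M ω` to a nearest point of `K`. No regularity of the rounding is needed, since only
    -- its error `e`, which is continuous, enters.
    have hround : ∀ ω, ∃ k, ‖kuratowskiEmbedding K k - W M ω‖ = e ω := fun ω => by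
      obtain ⟨_, ⟨k, rfl⟩, hk⟩ := (isCompact_range hι).exists_infDist_eq_dist
        (Set.range_nonempty _) (W M ω)
      exact ⟨k, by rw [← dist_eq_norm, dist_comm]; exact hk.symm⟩
    choose R hR using hround
    refine ⟨fun v => R (pullbackName (S.σ n) y v), hu _ ?_⟩
    have hN : (0 : ℝ) < Fintype.card (S.V n) := by exact_mod_cast Fintype.card_pos
    have hyO : ∀ j ∈ u, empirical (S.σ n) y ∈ D j := fun j hj => Set.mem_iInter₂.1 hy j hj
    rintro (⟨h, i⟩ | ⟨i, g⟩) hj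
    · have h1 := hyO _ hj
      simp only [Set.mem_ofPred_eq, C, D] at h1 ⊢
      rw [integral_empirical] at h1 ⊢
      exact h1.le
    · have h1 := hyO _ hj
      have h2 := hn _ hj i g rfl y
      simp only [Set.mem_ofPred_eq, C, D] at h1 ⊢
      -- The average of `q i` is taken at the places `σ g v`, where the lifted model is read at
      -- coordinate `g`.
      rw [integral_empirical, div_lt_iff₀ hN, ← Equiv.sum_comp (S.σ n g)] at h1
      rw [div_le_iff₀ hN] at h2
      rw [integral_empirical, div_le_iff₀ hN]
      calc _ ≤ ∑ v, (q i (pullbackName (S.σ n) y (S.σ n g v)) +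
            ‖W i (pullbackName (S.σ n) y (S.σ n g v)) -
              W i (shiftName g (pullbackName (S.σ n) y v))‖) := by
            refine Finset.sum_le_sum fun v _ => ?_
            have a1 := hR (pullbackName (S.σ n) y (S.σ n g v))
            have a2 := norm_add₃_le
              (a := kuratowskiEmbedding K (R (pullbackName (S.σ n) y (S.σ n g v))) -
                W M (pullbackName (S.σ n) y (S.σ n g v)))
              (b := W M (pullbackName (S.σ n) y (S.σ n g v)) -
                W i (pullbackName (S.σ n) y (S.σ n g v)))
              (c := W i (pullbackName (S.σ n) y (S.σ n g v)) -
                W i (shiftName g (pullbackName (S.σ n) y v)))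
            rw [sub_add_sub_cancel, sub_add_sub_cancel, a1] at a2
            exact a2
        _ ≤ _ := by
            rw [Finset.sum_add_distrib]
            linarith

/-- If the first process is a function of the second, then good joint models which are close in the
second coordinate are close in the first. -/
theorem exists_separation (Λ : ProbabilityMeasure (G → L × K)) {f : (G → K) → L}
    (hf : Measurable f) (hΛ : ∀ᵐ ω ∂(Λ : Measure (G → L × K)), (ω 1).1 = f fun g => (ω g).2)
    {δ : ℝ} (hδ : 0 < δ) :
    ∃ δ' > 0, ∃ O ∈ 𝓝 Λ, ∀ {V : Type} [Fintype V] [Nonempty V] (σ : G → Equiv.Perm V)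
      (y y' : V → L) (x x' : V → K), (fun v => (y v, x v)) ∈ goodModels O σ →
      (fun v => (y' v, x' v)) ∈ goodModels O σ → hammingAverage x x' < δ' →
      hammingAverage y y' < δ := by
  have hsnd : Measurable fun (ω : G → L × K) g => (ω g).2 :=
    measurable_pi_lambda _ fun g => (measurable_pi_apply g).snd
  have : IsProbabilityMeasure ((Λ : Measure (G → L × K)).map fun ω g => (ω g).2) :=
    Measure.isProbabilityMeasure_map hsnd.aemeasurable
  obtain ⟨W, hWc, hW, -⟩ := exists_continuous_approx
    ((Λ : Measure (G → L × K)).map fun ω g => (ω g).2) hf (ε := δ / 8) (by positivity)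
  have hι := (kuratowskiEmbedding.isometry L).continuous
  have hs : StronglyMeasurable fun ω => ‖kuratowskiEmbedding L (f ω) - W ω‖ :=
      ((stronglyMeasurable_kuratowski hf).sub hWc.stronglyMeasurable).norm
  rw [integral_map hsnd.aemeasurable hs.aestronglyMeasurable] at hW
  have hD : Continuous fun ω : G → L × K => ‖kuratowskiEmbedding L (ω 1).1 -
      W (fun g => (ω g).2)‖ :=
    ((hι.comp (by fun_prop)).sub (hWc.comp (by fun_prop))).norm
  obtain ⟨C, hC0, hC⟩ := exists_average_norm_sub_le hWc (ε := δ / 8) (by positivity)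
  refine ⟨δ / (8 * (C + 1)), by positivity, {ρ | ∫ ω, ‖kuratowskiEmbedding L (ω 1).1 -
      W (fun g => (ω g).2)‖ ∂(ρ : Measure (G → L × K)) < δ / 4}, ?_, ?_⟩
  · refine IsOpen.mem_nhds (isOpen_lt (ProbabilityMeasure.continuous_integral_continuousMap
      (⟨_, hD⟩ : C(G → L × K, ℝ))) continuous_const) ?_
    simp only [Set.mem_ofPred_eq]
    have : ∫ ω, ‖kuratowskiEmbedding L (ω 1).1 - W (fun g => (ω g).2)‖
          ∂(Λ : Measure (G → L × K)) =
        ∫ ω, ‖kuratowskiEmbedding L (f fun g => (ω g).2) - W (fun g => (ω g).2)‖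
          ∂(Λ : Measure (G → L × K)) := by
      refine integral_congr_ae ?_
      filter_upwards [hΛ] with ω hω
      rw [hω]
    rw [this]; linarith
  · intro V _ _ σ y y' x x' h h' hx
    have hN : (0 : ℝ) < Fintype.card V := by exact_mod_cast Fintype.card_pos
    simp only [goodModels, Set.mem_ofPred_eq] at h h'
    rw [integral_empirical] at h h'
    have h3 := hC σ x x'
    have h4 : C * hammingAverage x x' ≤ δ / 8 := by
      have : hammingAverage x x' * (8 * (C + 1)) < δ := (lt_div_iff₀ (by positivity)).1 hx
      have h0 : 0 ≤ hammingAverage x x' :=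
        div_nonneg (Finset.sum_nonneg fun _ _ => dist_nonneg) hN.le
      nlinarith
    -- The permutation `σ 1` need not be the identity, but the average is invariant under it. The
    -- errors then add up to less than `δ/4 + δ/4 + δ/8 + δ/8 < δ`.
    rw [← hammingAverage_comp_perm y y' (σ 1)]
    have pt : ∀ v, dist (y (σ 1 v)) (y' (σ 1 v)) ≤
        ‖kuratowskiEmbedding L (y (σ 1 v)) - W (pullbackName σ x v)‖ +
        ‖kuratowskiEmbedding L (y' (σ 1 v)) - W (pullbackName σ x' v)‖ +
        ‖W (pullbackName σ x v) - W (pullbackName σ x' v)‖ := fun v => by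
      rw [← (kuratowskiEmbedding.isometry L).dist_eq]
      have := dist_triangle4 (kuratowskiEmbedding L (y (σ 1 v))) (W (pullbackName σ x v))
        (W (pullbackName σ x' v)) (kuratowskiEmbedding L (y' (σ 1 v)))
      rw [dist_comm (W (pullbackName σ x' v))] at this
      simp only [← dist_eq_norm]
      linarith
    have h5 : (∑ v, dist (y (σ 1 v)) (y' (σ 1 v))) / Fintype.card V ≤
        (∑ v, ‖kuratowskiEmbedding L (y (σ 1 v)) - W (pullbackName σ x v)‖) / Fintype.card V +
        (∑ v, ‖kuratowskiEmbedding L (y' (σ 1 v)) - W (pullbackName σ x' v)‖) / Fintype.card V +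
        (∑ v, ‖W (pullbackName σ x v) - W (pullbackName σ x' v)‖) / Fintype.card V := by
      rw [← add_div, ← add_div, ← Finset.sum_add_distrib, ← Finset.sum_add_distrib]
      gcongr with v
      exact pt v
    change (∑ v, ‖kuratowskiEmbedding L (y (σ 1 v)) - W (pullbackName σ x v)‖) / _ < _ at h
    change (∑ v, ‖kuratowskiEmbedding L (y' (σ 1 v)) - W (pullbackName σ x' v)‖) / _ < _ at h'
    linarith

end Lift

/-! ### Entropy of observables -/

section Observables
variable {G Z L K : Type*} [Group G] [Countable G] [MeasurableSpace Z] [MulAction G Z]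
  [MeasurableConstSMul G Z]
  [MetricSpace L] [CompactSpace L] [MeasurableSpace L] [BorelSpace L]
  [MetricSpace K] [CompactSpace K] [MeasurableSpace K] [BorelSpace K]

omit [Countable G] [MetricSpace L] [CompactSpace L] [BorelSpace L] in
theorem map_shiftName_obsLaw (μ : Measure Z) [IsProbabilityMeasure μ] [SMulInvariantMeasure G Z μ]
    {ψ : Z → L} (hψ : Measurable ψ) (g : G) :
    (obsLaw G μ hψ : Measure (G → L)).map (shiftName g) = obsLaw G μ hψ := by
  change (μ.map (orbitName G ψ)).map (shiftName g) = μ.map (orbitName G ψ)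
  rw [Measure.map_map (measurable_shiftName g) (measurable_orbitName hψ)]
  conv_rhs => rw [← (measurePreserving_smul g μ).map_eq]
  rw [Measure.map_map (measurable_orbitName hψ) (measurable_const_smul g)]
  congr 1
  funext x
  exact (orbitName_smul ψ g x).symm

omit [MetricSpace L] [CompactSpace L] [BorelSpace L] [MetricSpace K] [CompactSpace K]
  [BorelSpace K] in
-- Invariance moves the almost sure identity to each `g • x`, and countability of `G` makes it hold
-- along whole orbits.
theorem obsLaw_prodMk_eq_map_codeGraph (μ : Measure Z) [IsProbabilityMeasure μ]
    [SMulInvariantMeasure G Z μ] {ψ : Z → L} (hψ : Measurable ψ) {φ : Z → K} (hφ : Measurable φ)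
    {f : (G → L) → K} (hf : Measurable f) (h : ∀ᵐ x ∂μ, φ x = f (orbitName G ψ x)) :
    (obsLaw G μ (hψ.prodMk hφ) : Measure (G → L × K)) =
      (obsLaw G μ hψ : Measure (G → L)).map (codeGraph f) := by
  change μ.map _ = (μ.map _).map _
  rw [Measure.map_map (measurable_codeGraph hf) (measurable_orbitName hψ)]
  have h' : ∀ᵐ x ∂μ, ∀ g : G, φ (g • x) = f (orbitName G ψ (g • x)) :=
    ae_all_iff.2 fun g => (measurePreserving_smul g μ).quasiMeasurePreserving.ae h
  refine Measure.map_congr ?_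
  filter_upwards [h'] with x hx
  funext g
  refine Prod.ext rfl ((hx g).trans ?_)
  rw [orbitName_smul]
  rfl

/-- Two observables which determine each other: the entropies of their processes agree. -/
theorem processEntropy_obsLaw_le (S : SoficApproximation G) (μ : Measure Z) [IsProbabilityMeasure μ]
    [SMulInvariantMeasure G Z μ] {ψ : Z → L} (hψ : Measurable ψ) {φ : Z → K} (hφ : Measurable φ)
    (h₁ : Determines G μ ψ φ) (h₂ : Determines G μ φ ψ) :
    processEntropy S (obsLaw G μ hψ) ≤ processEntropy S (obsLaw G μ hφ) := by
  obtain ⟨f, hf, hfe⟩ := h₁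
  obtain ⟨f', hf', hfe'⟩ := h₂
  refine iSup_le fun δ => iSup_le fun hδ => ?_
  -- The two hypotheses play different roles: the code from `ψ` to `φ` lifts models, while the code
  -- from `φ` back to `ψ` makes the lift expand distances enough to pull back covers.
  obtain ⟨δ', hδ', O₁, hO₁, hsep⟩ := exists_separation (obsLaw G μ (hψ.prodMk hφ)) hf' (by
    change ∀ᵐ ω ∂(μ.map _), _
    refine (ae_map_iff (measurable_orbitName (hψ.prodMk hφ)).aemeasurable ?_).2 ?_
    · exact measurableSet_eq_fun (measurable_pi_apply 1).fst
        (hf'.comp (measurable_pi_lambda _ fun g => (measurable_pi_apply g).snd))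
    · filter_upwards [hfe'] with x hx
      change ψ ((1 : G) • x) = _
      rwa [one_smul]) hδ
  refine le_iSup_of_le (δ' / 2) (le_iSup_of_le (half_pos hδ') (le_iInf fun O₂ => le_iInf fun hO₂ =>
    ?_))
  have hm : Measurable fun (ω : G → L × K) g => (ω g).2 :=
    measurable_pi_lambda _ fun g => (measurable_pi_apply g).snd
  have hc : Continuous fun ρ : ProbabilityMeasure (G → L × K) => ρ.map hm.aemeasurable :=
    ProbabilityMeasure.continuous_map (by fun_prop)
  have he : (obsLaw G μ (hψ.prodMk hφ)).map hm.aemeasurable = obsLaw G μ hφ := by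
    apply Subtype.ext
    exact Measure.map_map hm (measurable_orbitName (hψ.prodMk hφ))
  have hO' : O₁ ∩ (fun ρ : ProbabilityMeasure (G → L × K) => ρ.map hm.aemeasurable) ⁻¹' O₂ ∈
      𝓝 (obsLaw G μ (hψ.prodMk hφ)) :=
    inter_mem hO₁ (hc.continuousAt.preimage_mem_nhds (by rwa [he]))
  obtain ⟨O, hO, hlift⟩ := exists_lift_goodModels S (obsLaw G μ hψ) (map_shiftName_obsLaw μ hψ) hf
    (obsLaw G μ (hψ.prodMk hφ)) (obsLaw_prodMk_eq_map_codeGraph μ hψ hφ hf hfe) hO'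
  refine iInf_le_of_le O (iInf_le_of_le hO (limsup_le_limsup ?_))
  filter_upwards [hlift] with n hn
  refine modelRate_le_modelRate ?_
  have hK : ∀ y : S.V n → L, ∃ x : S.V n → K, y ∈ goodModels O (S.σ n) →
      (fun v => (y v, x v)) ∈ goodModels (O₁ ∩ (fun ρ : ProbabilityMeasure (G → L × K) =>
        ρ.map hm.aemeasurable) ⁻¹' O₂) (S.σ n) := fun y => by
    by_cases hy : y ∈ goodModels O (S.σ n)
    · obtain ⟨x, hx⟩ := hn y hy
      exact ⟨x, fun _ => hx⟩
    · have : Nonempty Z := nonempty_of_isProbabilityMeasure μ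
      exact ⟨fun _ => φ (Classical.arbitrary Z), fun h => absurd h hy⟩
  choose x hx using hK
  refine cov_le_cov_of_map x (fun y hy => ?_)
    (fun z _ => by rw [hammingAverage_self]; exact half_pos hδ') ?_
  · have := (hx y hy).2
    rw [Set.mem_preimage, empirical_map (p := Prod.snd) (hm := hm)] at this
    exact this
  · intro y hy y' hy' w _ h₁ h₂
    refine hsep (S.σ n) y y' (x y) (x y') (hx y hy).1 (hx y' hy').1 ?_
    have := hammingAverage_le_of_common h₁ h₂
    rwa [add_halves] at this

/-- Finiteness at a fixed scale excludes `⊤ + ⊥` in the proof of subadditivity. -/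
theorem iInf_limsup_modelRate_ne_top (S : SoficApproximation G) (m : ProbabilityMeasure (G → L))
    {δ : ℝ} (hδ : 0 < δ) : (⨅ O ∈ 𝓝 m, limsup (modelRate S δ O) atTop) ≠ ⊤ := by
  obtain ⟨C, hC⟩ := exists_modelRate_le L S hδ
  refine ne_top_of_le_ne_top (EReal.coe_ne_top C) ?_
  refine iInf_le_of_le Set.univ (iInf_le_of_le univ_mem ?_)
  exact limsup_le_of_le (by isBoundedDefault) (Eventually.of_forall fun n => hC _ n)

/-- Entropy is subadditive for pairs of observables. -/
theorem processEntropy_obsLaw_prodMk_le (S : SoficApproximation G) (μ : Measure Z)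
    [IsProbabilityMeasure μ] {ψ : Z → L} (hψ : Measurable ψ) {φ : Z → K} (hφ : Measurable φ) :
    processEntropy S (obsLaw G μ (hψ.prodMk hφ)) ≤
      processEntropy S (obsLaw G μ hψ) + processEntropy S (obsLaw G μ hφ) := by
  refine iSup_le fun δ => iSup_le fun hδ => ?_
  have h4 : 0 < δ / 4 := by positivity
  refine le_trans ?_ (add_le_add (le_iSup_of_le (δ / 4) (le_iSup_of_le h4 le_rfl))
    (le_iSup_of_le (δ / 4) (le_iSup_of_le h4 le_rfl)))
  refine EReal.le_add_of_forall_gt (.inr (iInf_limsup_modelRate_ne_top S _ h4))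
    (.inl (iInf_limsup_modelRate_ne_top S _ h4)) fun a ha b hb => ?_
  obtain ⟨O₁, hO₁⟩ := iInf_lt_iff.1 ha
  obtain ⟨hO₁, ha⟩ := iInf_lt_iff.1 hO₁
  obtain ⟨O₂, hO₂⟩ := iInf_lt_iff.1 hb
  obtain ⟨hO₂, hb⟩ := iInf_lt_iff.1 hO₂
  have hm₁ : Measurable fun (ω : G → L × K) g => (ω g).1 :=
    measurable_pi_lambda _ fun g => (measurable_pi_apply g).fst
  have hm₂ : Measurable fun (ω : G → L × K) g => (ω g).2 :=
    measurable_pi_lambda _ fun g => (measurable_pi_apply g).snd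
  have hc₁ : Continuous fun ρ : ProbabilityMeasure (G → L × K) => ρ.map hm₁.aemeasurable :=
    ProbabilityMeasure.continuous_map (by fun_prop)
  have hc₂ : Continuous fun ρ : ProbabilityMeasure (G → L × K) => ρ.map hm₂.aemeasurable :=
    ProbabilityMeasure.continuous_map (by fun_prop)
  have he₁ : (obsLaw G μ (hψ.prodMk hφ)).map hm₁.aemeasurable = obsLaw G μ hψ :=
    Subtype.ext (Measure.map_map hm₁ (measurable_orbitName (hψ.prodMk hφ)))
  have he₂ : (obsLaw G μ (hψ.prodMk hφ)).map hm₂.aemeasurable = obsLaw G μ hφ :=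
    Subtype.ext (Measure.map_map hm₂ (measurable_orbitName (hψ.prodMk hφ)))
  refine iInf_le_of_le
    ((fun ρ : ProbabilityMeasure (G → L × K) => ρ.map hm₁.aemeasurable) ⁻¹' O₁ ∩
      (fun ρ : ProbabilityMeasure (G → L × K) => ρ.map hm₂.aemeasurable) ⁻¹' O₂)
    (iInf_le_of_le (inter_mem (hc₁.continuousAt.preimage_mem_nhds (by rwa [he₁]))
      (hc₂.continuousAt.preimage_mem_nhds (by rwa [he₂]))) ?_)
  refine limsup_le_of_le (by isBoundedDefault) ?_
  filter_upwards [eventually_lt_of_limsup_lt ha, eventually_lt_of_limsup_lt hb] with n hn₁ hn₂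
  refine le_trans (modelRate_le_add ?_) (add_le_add hn₁.le hn₂.le)
  refine cov_le_cov_mul_cov (fun x v => (x v).1) (fun x v => (x v).2) (fun x hx => ?_)
    (fun x hx => ?_) (fun z _ => by rwa [hammingAverage_self])
    (fun z _ => by rwa [hammingAverage_self]) ?_
  · have := hx.1
    rw [Set.mem_preimage, empirical_map (p := Prod.fst) (hm := hm₁)] at this
    exact this
  · have := hx.2
    rw [Set.mem_preimage, empirical_map (p := Prod.snd) (hm := hm₂)] at this
    exact this
  · intro x _ x' _ w₁ _ w₂ _ h₁ h₁' h₂ h₂'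
    have a₁ := hammingAverage_le_of_common h₁ h₁'
    have a₂ := hammingAverage_le_of_common h₂ h₂'
    have : hammingAverage x x' ≤ hammingAverage (fun v => (x v).1) (fun v => (x' v).1) +
        hammingAverage (fun v => (x v).2) (fun v => (x' v).2) := by
      rw [hammingAverage, hammingAverage, hammingAverage, ← add_div, ← Finset.sum_add_distrib]
      gcongr with v
      rw [Prod.dist_eq]
      exact max_le_add_of_nonneg dist_nonneg dist_nonneg
    linarith

omit [Countable G] [CompactSpace L] [BorelSpace L] in
-- A negative limit superior means negative rates for all large `n`. Then there are no good models
-- at all and every such rate is `⊥`.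
theorem limsup_modelRate_nonneg (S : SoficApproximation G) {δ : ℝ} (hδ : 0 < δ)
    {O : Set (ProbabilityMeasure (G → L))} (h : limsup (modelRate S δ O) atTop ≠ ⊥) :
    0 ≤ limsup (modelRate S δ O) atTop := by
  by_contra hlt
  refine h (le_bot_iff.1 (limsup_le_of_le (by isBoundedDefault) ?_))
  filter_upwards [eventually_lt_of_limsup_lt (not_le.1 hlt)] with n hn
  rw [modelRate_eq_bot hδ]
  rw [← modelRate_nonneg_iff hδ]
  exact not_le.2 hn

theorem processEntropy_nonneg (S : SoficApproximation G) {m : ProbabilityMeasure (G → L)}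
    (h : processEntropy S m ≠ ⊥) : 0 ≤ processEntropy S m := by
  obtain ⟨δ, h⟩ := not_forall.1 (mt iSup_eq_bot.2 h)
  obtain ⟨hδ, h⟩ := not_forall.1 (mt iSup_eq_bot.2 h)
  refine le_iSup_of_le δ (le_iSup_of_le hδ (le_iInf fun O => le_iInf fun hO => ?_))
  refine limsup_modelRate_nonneg S hδ fun hb => h (le_bot_iff.1 ?_)
  exact iInf_le_of_le O (iInf_le_of_le hO hb.le)

end Observables

/-! ### Entropy of systems -/

section Systems
variable {G : Type*} [Group G] [Countable G] (S : SoficApproximation G)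
  {Z X Y : Type*} [MeasurableSpace Z] [MulAction G Z] [MeasurableConstSMul G Z]
  [MeasurableSpace X] [MulAction G X] [MeasurableConstSMul G X]
  [MeasurableSpace Y] [MulAction G Y] [MeasurableConstSMul G Y]

theorem soficEntropy_nonneg {μ : Measure X} [IsProbabilityMeasure μ] (h : soficEntropy S μ ≠ ⊥) :
    0 ≤ soficEntropy S μ := by
  obtain ⟨d, h⟩ := not_forall.1 (mt iSup_eq_bot.2 h)
  let _ := d.metric
  have := d.compact
  have := d.borel
  exact le_iSup_of_le d (processEntropy_nonneg S h)

/-- An observable with which the system is generated computes at least the entropy of the system. -/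
theorem soficEntropy_le_processEntropy {K : Type*} [MetricSpace K] [CompactSpace K]
    [MeasurableSpace K] [BorelSpace K] (μ : Measure X) [IsProbabilityMeasure μ]
    [SMulInvariantMeasure G X μ] {φ : X → K} (hφ : Measurable φ) (h : Determines G μ φ id) :
    soficEntropy S μ ≤ processEntropy S (obsLaw G μ hφ) := by
  refine iSup_le fun d => ?_
  let _ := d.metric
  have := d.compact
  have := d.borel
  exact processEntropy_obsLaw_le S μ measurable_id hφ
    ⟨fun ω => φ (ω 1), hφ.comp (measurable_pi_apply 1), by simp [orbitName]⟩ h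

/-- An observable with which the system is generated computes at most the entropy of the system. -/
theorem processEntropy_le_soficEntropy [StandardBorelSpace X] {K : Type*} [MetricSpace K]
    [CompactSpace K]
    [MeasurableSpace K] [BorelSpace K] (μ : Measure X) [IsProbabilityMeasure μ]
    [SMulInvariantMeasure G X μ] {φ : X → K} (hφ : Measurable φ) (h : Determines G μ φ id) :
    processEntropy S (obsLaw G μ hφ) ≤ soficEntropy S μ := by
  obtain ⟨d⟩ := nonempty_compactGeneratingMetric X
  refine le_iSup_of_le d ?_
  let _ := d.metric
  have := d.compact
  have := d.borel
  exact processEntropy_obsLaw_le S μ hφ measurable_id h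
    ⟨fun ω => φ (ω 1), hφ.comp (measurable_pi_apply 1), by simp [orbitName]⟩

omit [Countable G] [MeasurableConstSMul G Z] in
-- By Lusin–Souslin an injective measurable map on a standard Borel space is a measurable embedding,
-- so it has a measurable left inverse. Only the coordinate of the name at the identity is read.
theorem determines_id_of_injective {K : Type*} [MeasurableSpace K]
    [MeasurableSpace.CountablySeparated K] [StandardBorelSpace Z] (ρ : Measure Z)
    [IsProbabilityMeasure ρ] {φ : Z → K} (hφ : Measurable φ) (hi : Function.Injective φ) :
    Determines G ρ φ id := by
  have : Nonempty Z := nonempty_of_isProbabilityMeasure ρ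
  obtain ⟨r, hr, hre⟩ := (hφ.measurableEmbedding hi).exists_measurable_extend measurable_id
    fun _ => this
  refine ⟨fun ω => r (ω 1), hr.comp (measurable_pi_apply 1), Eventually.of_forall fun z => ?_⟩
  simpa [orbitName] using (congrFun hre z).symm

omit [Countable G] in
-- Lets the entropy of a factor be computed as that of an observable on the larger system, which
-- puts both sides of a joining inequality on one space.
theorem obsLaw_eq_orbitLaw {ρ : Measure Z} [IsProbabilityMeasure ρ] {μ : Measure X}
    [IsProbabilityMeasure μ] {π : Z → X} (hπ : MeasurePreserving π ρ μ)
    (he : ∀ (g : G) z, π (g • z) = g • π z) : obsLaw G ρ hπ.measurable = orbitLaw G μ := by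
  apply Subtype.ext
  change ρ.map _ = μ.map _
  rw [← hπ.map_eq, Measure.map_map (measurable_pi_lambda _ fun h => measurable_const_smul h)
    hπ.measurable]
  congr 1
  funext z g
  exact he g z

/-- Entropy is subadditive for joinings. -/
theorem soficEntropy_le_add [StandardBorelSpace Z] [StandardBorelSpace X] [StandardBorelSpace Y]
    {ρ : Measure Z} [IsProbabilityMeasure ρ] [SMulInvariantMeasure G Z ρ]
    {μ : Measure X} [IsProbabilityMeasure μ] {ν : Measure Y} [IsProbabilityMeasure ν]
    {π₁ : Z → X} {π₂ : Z → Y} (h₁ : MeasurePreserving π₁ ρ μ) (h₂ : MeasurePreserving π₂ ρ ν)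
    (he₁ : ∀ (g : G) z, π₁ (g • z) = g • π₁ z) (he₂ : ∀ (g : G) z, π₂ (g • z) = g • π₂ z)
    (hi : Function.Injective fun z => (π₁ z, π₂ z)) :
    soficEntropy S ρ ≤ soficEntropy S μ + soficEntropy S ν := by
  have hdet := determines_id_of_injective (G := G) ρ (h₁.measurable.prodMk h₂.measurable) hi
  obtain ⟨d₁⟩ := nonempty_compactGeneratingMetric X
  obtain ⟨d₂⟩ := nonempty_compactGeneratingMetric Y
  let _ := d₁.metric
  have := d₁.compact
  have := d₁.borel
  let _ := d₂.metric
  have := d₂.compact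
  have := d₂.borel
  have k₁ : processEntropy S (orbitLaw G μ) ≤ soficEntropy S μ := le_iSup_of_le d₁ le_rfl
  have k₂ : processEntropy S (orbitLaw G ν) ≤ soficEntropy S ν := le_iSup_of_le d₂ le_rfl
  refine le_trans ?_ (add_le_add k₁ k₂)
  rw [← obsLaw_eq_orbitLaw h₁ he₁, ← obsLaw_eq_orbitLaw h₂ he₂]
  exact (soficEntropy_le_processEntropy S ρ (h₁.measurable.prodMk h₂.measurable) hdet).trans
    (processEntropy_obsLaw_prodMk_le S ρ h₁.measurable h₂.measurable)

/-- Isomorphism invariance. -/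
theorem soficEntropy_le_of_injective [StandardBorelSpace Z] [StandardBorelSpace X]
    {ρ : Measure Z} [IsProbabilityMeasure ρ] [SMulInvariantMeasure G Z ρ]
    {μ : Measure X} [IsProbabilityMeasure μ]
    {π : Z → X} (h : MeasurePreserving π ρ μ)
    (he : ∀ (g : G) z, π (g • z) = g • π z) (hi : Function.Injective π) :
    soficEntropy S ρ ≤ soficEntropy S μ := by
  have hdet := determines_id_of_injective (G := G) ρ h.measurable hi
  obtain ⟨d⟩ := nonempty_compactGeneratingMetric X
  let _ := d.metric
  have := d.compact
  have := d.borel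
  have k : processEntropy S (orbitLaw G μ) ≤ soficEntropy S μ := le_iSup_of_le d le_rfl
  refine le_trans ?_ k
  rw [← obsLaw_eq_orbitLaw h he]
  exact soficEntropy_le_processEntropy S ρ h.measurable hdet

end Systems

/-! ### Almost orthogonal families -/

/-- Only boundedly many members of an almost orthogonal family correlate with a given vector. -/
theorem card_le_of_almost_orthogonal {V ι : Type*} [Fintype V] [Nonempty V] (u : ι → V → ℝ)
    (w : V → ℝ) (T : Finset ι) {B β ε : ℝ} (hB : 0 < B) (hε : 0 < ε)
    (hβ : β * (2 * B ^ 2) ≤ ε ^ 2)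
    (hu : ∀ i v, |u i v| ≤ B) (hw : ∀ v, |w v| ≤ B)
    (horth : ∀ i ∈ T, ∀ j ∈ T, i ≠ j → |∑ v, u i v * u j v| ≤ β * Fintype.card V)
    (hcorr : ∀ i ∈ T, ε * Fintype.card V ≤ |∑ v, u i v * w v|) :
    (T.card : ℝ) ≤ 2 * B ^ 4 / ε ^ 2 := by
  classical
  have hN : (0 : ℝ) < Fintype.card V := by exact_mod_cast Fintype.card_pos
  set N : ℝ := (Fintype.card V : ℝ)
  set t : ℝ := (T.card : ℝ)
  rcases T.eq_empty_or_nonempty with hT | hT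
  · simp only [t, hT, Finset.card_empty, Nat.cast_zero]; positivity
  have ht : 0 < t := by simpa [t] using hT
  -- With these signs the inner product of `w` with `∑ s i * u i` is the sum of all absolute
  -- correlations. Cauchy–Schwarz compares it with the norm of that sum, which almost orthogonality
  -- keeps small.
  let s : ι → ℝ := fun i => SignType.sign (∑ v, u i v * w v)
  have hs : ∀ i, |s i| ≤ 1 := fun i => by
    rcases SignType.trichotomy (SignType.sign (∑ v, u i v * w v)) with h | h | h <;> simp [s, h]
  have hsum : t * (ε * N) ≤ ∑ v, w v * ∑ i ∈ T, s i * u i v := by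
    have : ∑ v, w v * ∑ i ∈ T, s i * u i v = ∑ i ∈ T, |∑ v, u i v * w v| := by
      simp only [Finset.mul_sum]
      rw [Finset.sum_comm]
      refine Finset.sum_congr rfl fun i _ => ?_
      rw [← sign_mul_self (∑ v, u i v * w v), Finset.mul_sum]
      exact Finset.sum_congr rfl fun v _ => by simp only [s]; ring
    rw [this]
    calc t * (ε * N) = ∑ i ∈ T, ε * N := by simp [t]
      _ ≤ _ := Finset.sum_le_sum hcorr
  have hcs := Finset.sum_mul_sq_le_sq_mul_sq Finset.univ w fun v => ∑ i ∈ T, s i * u i v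
  have h1 : ∑ v, w v ^ 2 ≤ N * B ^ 2 := by
    calc ∑ v, w v ^ 2 ≤ ∑ v : V, B ^ 2 := Finset.sum_le_sum fun v _ => by
          rw [← sq_abs]; gcongr; exact hw v
      _ = _ := by simp [N]
  have hpair : ∀ i ∈ T, ∀ j ∈ T, s i * s j * ∑ v, u i v * u j v ≤
      β * N + if i = j then N * B ^ 2 - β * N else 0 := by
    intro i hi j hj
    have hss : |s i * s j| ≤ 1 := by
      rw [abs_mul]; exact mul_le_one₀ (hs i) (abs_nonneg _) (hs j)
    have h0 : s i * s j * ∑ v, u i v * u j v ≤ |∑ v, u i v * u j v| := by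
      refine (le_abs_self _).trans ?_
      rw [abs_mul]
      exact mul_le_of_le_one_left (abs_nonneg _) hss
    refine h0.trans ?_
    split_ifs with hij
    · subst hij
      have : |∑ v, u i v * u i v| ≤ N * B ^ 2 := by
        refine (Finset.abs_sum_le_sum_abs _ _).trans ?_
        calc ∑ v, |u i v * u i v| ≤ ∑ v : V, B ^ 2 := Finset.sum_le_sum fun v _ => by
              rw [abs_mul, ← sq]; gcongr; exact hu i v
          _ = _ := by simp [N]
      linarith
    · simpa using horth i hi j hj hij
  have h2 : ∑ v, (∑ i ∈ T, s i * u i v) ^ 2 ≤ t ^ 2 * (β * N) + t * (N * B ^ 2 - β * N) := by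
    have : ∑ v, (∑ i ∈ T, s i * u i v) ^ 2 =
        ∑ i ∈ T, ∑ j ∈ T, s i * s j * ∑ v, u i v * u j v := by
      simp_rw [sq, Finset.sum_mul_sum]
      rw [Finset.sum_comm]
      refine Finset.sum_congr rfl fun i _ => ?_
      rw [Finset.sum_comm]
      refine Finset.sum_congr rfl fun j _ => ?_
      rw [Finset.mul_sum]
      exact Finset.sum_congr rfl fun v _ => by ring
    rw [this]
    refine (Finset.sum_le_sum fun i hi => Finset.sum_le_sum fun j hj => hpair i hi j hj).trans ?_
    simp only [Finset.sum_add_distrib, Finset.sum_const, Finset.sum_ite_eq, nsmul_eq_mul]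
    rw [Finset.sum_congr rfl fun i hi => if_pos hi]
    simp only [Finset.sum_const, nsmul_eq_mul]
    apply le_of_eq; ring
  have h3 : (t * (ε * N)) ^ 2 ≤ N * B ^ 2 * (t ^ 2 * (β * N) + t * (N * B ^ 2 - β * N)) := by
    refine (pow_le_pow_left₀ (by positivity) hsum 2).trans (hcs.trans ?_)
    exact mul_le_mul h1 h2 (Finset.sum_nonneg fun v _ => sq_nonneg _) (by positivity)
  -- Two distinct members bound an absolute value by `β * N`, so a negative `β` is possible only
  -- when `T` has at most one element.
  have hβ0 : 0 ≤ β ∨ T.card ≤ 1 := by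
    by_cases h : T.card ≤ 1
    · exact .inr h
    · obtain ⟨i, hi, j, hj, hij⟩ := Finset.one_lt_card.1 (not_le.1 h)
      have := (abs_nonneg _).trans (horth i hi j hj hij)
      exact .inl (nonneg_of_mul_nonneg_left this hN)
  rw [le_div_iff₀ (by positivity)]
  have h4 : t * ε ^ 2 ≤ B ^ 2 * (t * β + (B ^ 2 - β)) := by
    have hp : 0 < t * N ^ 2 := by positivity
    refine le_of_mul_le_mul_left ?_ hp
    calc t * N ^ 2 * (t * ε ^ 2) = (t * (ε * N)) ^ 2 := by ring
      _ ≤ _ := h3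
      _ = _ := by ring
  rcases hβ0 with h | h
  · nlinarith [mul_nonneg (sq_nonneg B) h, mul_le_mul_of_nonneg_left hβ ht.le]
  · have ht1 : t = 1 := by
      have : T.card = 1 := le_antisymm h hT.card_pos
      simp [t, this]
    rw [ht1] at h4 ⊢
    nlinarith [sq_nonneg (B ^ 2)]

/-! ### Models of a power and of a product -/

section Quenched
variable {G A Y : Type*} [Countable G]
  [MetricSpace A] [CompactSpace A] [MeasurableSpace A] [BorelSpace A]
  [MetricSpace Y] [CompactSpace Y] [MeasurableSpace Y] [BorelSpace Y]

/-- In a good model of a high power, all but a bounded number of the coordinates together with a good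
model `y` of the second process form a good model of the product. -/
theorem exists_card_bad_le (mA : ProbabilityMeasure (G → A)) (mY : ProbabilityMeasure (G → Y))
    (Λ : ProbabilityMeasure (G → A × Y))
    (hΛ : (Λ : Measure (G → A × Y)).map (fun ω => ((fun g => (ω g).1), fun g => (ω g).2)) =
      (mA : Measure (G → A)).prod (mY : Measure (G → Y)))
    {O : Set (ProbabilityMeasure (G → A × Y))} (hO : O ∈ 𝓝 Λ) :
    ∃ N₀ : ℕ, ∀ (k : ℕ) (Λk : ProbabilityMeasure (G → Fin k → A)),
      (∀ i j, i ≠ j → (Λk : Measure (G → Fin k → A)).map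
        (fun ω => ((fun g => ω g i), fun g => ω g j)) =
          (mA : Measure (G → A)).prod (mA : Measure (G → A))) →
      ∃ Ok ∈ 𝓝 Λk, ∃ OY ∈ 𝓝 mY, ∀ {V : Type} [Fintype V] [Nonempty V] (σ : G → Equiv.Perm V)
        (z : V → Fin k → A) (y : V → Y), z ∈ goodModels Ok σ → y ∈ goodModels OY σ →
        {i | (fun v => (z v i, y v)) ∉ goodModels O σ}.ncard ≤ N₀ := by
  classical
  have hsplit : Measurable fun ω : G → A × Y => ((fun g => (ω g).1), fun g => (ω g).2) :=
    (measurable_pi_lambda _ fun g => (measurable_pi_apply g).fst).prodMk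
      (measurable_pi_lambda _ fun g => (measurable_pi_apply g).snd)
  -- Correlations of product test functions characterise the product law, so finitely many of them
  -- force membership in `O`. The resulting finite set depends on `O` alone, which is why `N₀` can
  -- be chosen before `k`.
  let C : C(G → A, ℝ) × C(G → Y, ℝ) × ℕ → Set (ProbabilityMeasure (G → A × Y)) := fun j =>
    {ρ | |∫ ω, j.1 (fun g => (ω g).1) * j.2.1 (fun g => (ω g).2) ∂(ρ : Measure (G → A × Y)) -
      (∫ ω, j.1 ω ∂(mA : Measure (G → A))) * ∫ ω, j.2.1 ω ∂(mY : Measure (G → Y))| ≤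
      1 / ((j.2.2 : ℝ) + 1)}
  have hC : ∀ j, IsClosed (C j) := fun j => by
    have := ProbabilityMeasure.continuous_integral_continuousMap (X := G → A × Y)
      (⟨fun ω => j.1 (fun g => (ω g).1) * j.2.1 (fun g => (ω g).2), by fun_prop⟩ :
        C(G → A × Y, ℝ))
    exact isClosed_le (this.sub continuous_const).abs continuous_const
  obtain ⟨u, hu⟩ := exists_finset_biInter_subset hO C hC (by
    intro ρ hρ
    have hint : ∀ (ρ : ProbabilityMeasure (G → A × Y)) (F : BoundedContinuousFunction (G → A) ℝ)
        (H : BoundedContinuousFunction (G → Y) ℝ),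
        ∫ p, F p.1 * H p.2 ∂((ρ : Measure (G → A × Y)).map
          (fun ω => ((fun g => (ω g).1), fun g => (ω g).2))) =
        ∫ ω, F (fun g => (ω g).1) * H (fun g => (ω g).2) ∂(ρ : Measure (G → A × Y)) :=
      fun ρ F H => integral_map hsplit.aemeasurable
        (Continuous.aestronglyMeasurable (by fun_prop))
    have hprob : IsProbabilityMeasure ((ρ : Measure (G → A × Y)).map
          (fun ω => ((fun g => (ω g).1), fun g => (ω g).2))) :=
      Measure.isProbabilityMeasure_map hsplit.aemeasurable
    have h1 : (ρ : Measure (G → A × Y)).map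
          (fun ω => ((fun g => (ω g).1), fun g => (ω g).2)) =
          (mA : Measure (G → A)).prod (mY : Measure (G → Y)) := by
      refine Measure.eq_prod_of_integral_mul_boundedContinuousFunction fun F H => ?_
      rw [hint]
      have hlim : Tendsto (fun i : ℕ => 1 / ((i : ℝ) + 1)) atTop (𝓝 0) :=
        tendsto_one_div_add_atTop_nhds_zero_nat
      have h0 : |∫ ω, F (fun g => (ω g).1) * H (fun g => (ω g).2) ∂(ρ : Measure (G → A × Y)) -
          (∫ ω, F ω ∂(mA : Measure (G → A))) * ∫ ω, H ω ∂(mY : Measure (G → Y))| ≤ 0 :=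
        ge_of_tendsto' hlim fun i => hρ (F.toContinuousMap, H.toContinuousMap, i)
      exact sub_eq_zero.1 (abs_eq_zero.1 (le_antisymm h0 (abs_nonneg _)))
    apply Subtype.ext
    have hjoin : Measurable fun (p : (G → A) × (G → Y)) g => (p.1 g, p.2 g) := by fun_prop
    have hid : ∀ ρ : ProbabilityMeasure (G → A × Y), ((ρ : Measure (G → A × Y)).map
          (fun ω => ((fun g => (ω g).1), fun g => (ω g).2))).map
            (fun (p : (G → A) × (G → Y)) g => (p.1 g, p.2 g)) = ρ := fun ρ => by
      rw [Measure.map_map hjoin hsplit]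
      exact Measure.map_id
    change (ρ : Measure (G → A × Y)) = Λ
    rw [← hid ρ, ← hid Λ, h1, hΛ])
  -- centred functions and bounds
  let F₀ : C(G → A, ℝ) × C(G → Y, ℝ) × ℕ → C(G → A, ℝ) := fun j => j.1 - .const _ (∫ ω, j.1 ω ∂(mA : Measure (G → A)))
  have hF₀ : ∀ j, ∫ ω, F₀ j ω ∂(mA : Measure (G → A)) = 0 := fun j => by
    have : ∫ ω, (j.1 ω - ∫ ω, j.1 ω ∂(mA : Measure (G → A))) ∂(mA : Measure (G → A)) = 0 := by
      rw [integral_sub (integrable_of_continuous _ j.1.continuous) (integrable_const _)]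
      simp
    exact this
  let B : C(G → A, ℝ) × C(G → Y, ℝ) × ℕ → ℝ := fun j => ‖F₀ j‖ + ‖j.2.1‖ + 1
  have hB : ∀ j, 0 < B j := fun j => by positivity
  let ε : C(G → A, ℝ) × C(G → Y, ℝ) × ℕ → ℝ := fun j => 1 / ((j.2.2 : ℝ) + 1)
  have hε : ∀ j, 0 < ε j := fun j => by positivity
  -- The largest `β` that `card_le_of_almost_orthogonal` admits for the threshold `ε j / 2`.
  let β : C(G → A, ℝ) × C(G → Y, ℝ) × ℕ → ℝ := fun j => (ε j / 2) ^ 2 / (2 * B j ^ 2)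
  have hβ : ∀ j, 0 < β j := fun j => by have := hB j; have := hε j; positivity
  refine ⟨∑ j ∈ u, ⌊2 * B j ^ 4 / (ε j / 2) ^ 2⌋₊, fun k Λk hΛk => ?_⟩
  have hpair : ∀ (i i' : Fin k), Measurable fun ω : G → Fin k → A =>
      ((fun g => ω g i), fun g => ω g i') := fun i i' => by fun_prop
  -- The condition on `z` is almost orthogonality of distinct coordinates. The condition on `y`
  -- controls the term lost by centring, namely the mean of `F` times the deviation of the average
  -- of `H`.
  refine ⟨⋂ j ∈ u, ⋂ (i : Fin k) (i' : Fin k), {ρ | i ≠ i' → |∫ ω, F₀ j (fun g => ω g i) *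
    F₀ j (fun g => ω g i') ∂(ρ : Measure (G → Fin k → A))| < β j}, ?_,
    ⋂ j ∈ u, {ρ | |∫ ω, j.1 ω ∂(mA : Measure (G → A))| *
      |∫ ω, j.2.1 ω ∂(ρ : Measure (G → Y)) - ∫ ω, j.2.1 ω ∂(mY : Measure (G → Y))| < ε j / 2},
    ?_, ?_⟩
  · refine (Filter.biInter_finset_mem u).2 fun j _ => ?_
    refine Filter.iInter_mem.2 fun i => Filter.iInter_mem.2 fun i' => ?_
    by_cases hii : i = i'
    · simp [hii]
    · have hc := ProbabilityMeasure.continuous_integral_continuousMap (X := G → Fin k → A)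
        (⟨fun ω => F₀ j (fun g => ω g i) * F₀ j (fun g => ω g i'), by fun_prop⟩ :
          C(G → Fin k → A, ℝ))
      have h0 : ∫ ω, F₀ j (fun g => ω g i) * F₀ j (fun g => ω g i')
          ∂(Λk : Measure (G → Fin k → A)) = 0 := by
        have h1 := integral_map (μ := (Λk : Measure (G → Fin k → A))) (hpair i i').aemeasurable
          (f := fun p => F₀ j p.1 * F₀ j p.2) (Continuous.aestronglyMeasurable (by fun_prop))
        rw [hΛk i i' hii] at h1
        rw [← h1, integral_prod_mul, hF₀, zero_mul]
      filter_upwards [(isOpen_lt hc.abs continuous_const).mem_nhds (by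
        change |(∫ ω, F₀ j (fun g => ω g i) * F₀ j (fun g => ω g i')
          ∂(Λk : Measure (G → Fin k → A)))| < β j
        rw [h0, abs_zero]; exact hβ j)] with ρ hρ _
      exact hρ
  · refine (Filter.biInter_finset_mem u).2 fun j _ => ?_
    refine IsOpen.mem_nhds (isOpen_lt (continuous_const.mul
      ((ProbabilityMeasure.continuous_integral_continuousMap j.2.1).sub continuous_const).abs)
        continuous_const) ?_
    change |∫ ω, j.1 ω ∂(mA : Measure (G → A))| *
      |∫ ω, j.2.1 ω ∂(mY : Measure (G → Y)) - ∫ ω, j.2.1 ω ∂(mY : Measure (G → Y))| < ε j / 2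
    rw [sub_self, abs_zero, mul_zero]
    exact half_pos (hε j)
  · intro V _ _ σ z y hz hy
    have hN : (0 : ℝ) < Fintype.card V := by exact_mod_cast Fintype.card_pos
    let x : Fin k → V → A := fun i v => z v i
    let T : C(G → A, ℝ) × C(G → Y, ℝ) × ℕ → Finset (Fin k) := fun j => Finset.univ.filter fun i =>
      ε j / 2 * Fintype.card V ≤
        |∑ v, F₀ j (pullbackName σ (x i) v) * j.2.1 (pullbackName σ y v)|
    have hT : ∀ j ∈ u, (T j).card ≤ ⌊2 * B j ^ 4 / (ε j / 2) ^ 2⌋₊ := by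
      intro j hj
      refine Nat.le_floor (card_le_of_almost_orthogonal
        (fun i v => F₀ j (pullbackName σ (x i) v)) (fun v => j.2.1 (pullbackName σ y v)) (T j)
        (β := β j) (hB j) (half_pos (hε j)) ?_ (fun i v => ?_) (fun v => ?_) ?_ ?_)
      · have := hB j
        rw [div_mul_cancel₀ _ (by positivity)]
      · have := (F₀ j).norm_coe_le_norm (pullbackName σ (x i) v)
        rw [Real.norm_eq_abs] at this
        have h2 := norm_nonneg j.2.1
        simp only [B]; linarith
      · have := j.2.1.norm_coe_le_norm (pullbackName σ y v)
        rw [Real.norm_eq_abs] at this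
        have h2 := norm_nonneg (F₀ j)
        simp only [B]; linarith
      · intro i _ i' _ hii
        have h1 := Set.mem_iInter.1 (Set.mem_iInter.1 (Set.mem_iInter₂.1 hz j hj) i) i' hii
        rw [integral_empirical, abs_div, abs_of_pos hN, div_lt_iff₀ hN] at h1
        exact h1.le
      · intro i hi
        exact (Finset.mem_filter.1 hi).2
    have hsub : {i | (fun v => (z v i, y v)) ∉ goodModels O σ} ⊆ (u.biUnion T : Finset (Fin k)) := by
      intro i hi
      by_contra hni
      refine hi (hu _ fun j hj => ?_)
      have h1 : i ∉ T j := fun h => hni (by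
        rw [Finset.mem_coe, Finset.mem_biUnion]; exact ⟨j, hj, h⟩)
      have h2 : |∑ v, F₀ j (pullbackName σ (x i) v) * j.2.1 (pullbackName σ y v)| <
          ε j / 2 * Fintype.card V := by
        simpa [T] using h1
      have h3 := Set.mem_iInter₂.1 hy j hj
      change |∫ ω, j.1 ω ∂(mA : Measure (G → A))| * |(∫ ω, j.2.1 ω ∂(empirical σ y :
        Measure (G → Y))) - ∫ ω, j.2.1 ω ∂(mY : Measure (G → Y))| < ε j / 2 at h3
      rw [integral_empirical] at h3
      change |(∫ ω, j.1 (fun g => (ω g).1) * j.2.1 (fun g => (ω g).2)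
        ∂(empirical σ (fun v => (z v i, y v)) : Measure (G → A × Y))) - _| ≤ ε j
      rw [integral_empirical]
      change |(∑ v, j.1 (pullbackName σ (x i) v) * j.2.1 (pullbackName σ y v)) / Fintype.card V -
        _| ≤ ε j
      set I := ∫ ω, j.1 ω ∂(mA : Measure (G → A))
      have h4 : ∀ v, F₀ j (pullbackName σ (x i) v) = j.1 (pullbackName σ (x i) v) - I :=
        fun v => rfl
      simp only [h4, sub_mul, Finset.sum_sub_distrib, ← Finset.mul_sum] at h2
      rw [← abs_of_pos hN, ← div_lt_iff₀ (abs_pos.2 hN.ne'), ← abs_div, sub_div, mul_div_assoc] at h2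
      rw [← abs_mul, mul_sub] at h3
      -- Each half of `ε j` has its own source: the centred correlation, and the mean of `F` times
      -- the error in the average of `H`.
      have h5 := abs_add_le ((∑ v, j.1 (pullbackName σ (x i) v) * j.2.1 (pullbackName σ y v)) /
        Fintype.card V - I * ((∑ v, j.2.1 (pullbackName σ y v)) / Fintype.card V))
        (I * ((∑ v, j.2.1 (pullbackName σ y v)) / Fintype.card V) -
          I * ∫ ω, j.2.1 ω ∂(mY : Measure (G → Y)))
      rw [sub_add_sub_cancel] at h5
      linarith
    calc {i | (fun v => (z v i, y v)) ∉ goodModels O σ}.ncard ≤ (u.biUnion T).card := by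
          rw [← Set.ncard_coe_finset]
          exact Set.ncard_le_ncard hsub (Finset.finite_toSet _)
      _ ≤ ∑ j ∈ u, (T j).card := Finset.card_biUnion_le
      _ ≤ _ := Finset.sum_le_sum hT

end Quenched

/-! ### Counting -/

/-- A bound for the number of tuples which have all but a few entries in `B`. -/
theorem card_mul_pow_le {W : Type*} [Fintype W] [DecidableEq W] {k N₀ : ℕ} (Z : Finset (Fin k → W))
    (B : Finset W) (hZ : ∀ z ∈ Z, {i | z i ∉ B}.ncard ≤ N₀) {t : ℝ} (ht : 0 < t) (ht1 : t ≤ 1) :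
    Z.card * t ^ N₀ ≤ (B.card + t * Fintype.card W) ^ k := by
  -- An exponential moment bound: every tuple in `Z` has product weight at least `t ^ N₀`, while the
  -- total weight of all tuples factorises.
  let w : W → ℝ := fun x => if x ∈ B then 1 else t
  have hw : ∀ x, 0 ≤ w x := fun x => by simp only [w]; split_ifs <;> positivity
  have h1 : ∀ z ∈ Z, t ^ N₀ ≤ ∏ i, w (z i) := fun z hz => by
    have : ∏ i, w (z i) = t ^ {i | z i ∉ B}.ncard := by
      rw [Set.ncard_eq_toFinset_card', Set.toFinset_ofPred]
      simp only [w]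
      rw [Finset.prod_ite, Finset.prod_const_one, Finset.prod_const, one_mul]
    rw [this]
    exact pow_le_pow_of_le_one ht.le ht1 (hZ z hz)
  calc (Z.card : ℝ) * t ^ N₀ = ∑ z ∈ Z, t ^ N₀ := by simp
    _ ≤ ∑ z ∈ Z, ∏ i, w (z i) := Finset.sum_le_sum h1
    _ ≤ ∑ z : Fin k → W, ∏ i, w (z i) := Finset.sum_le_sum_of_subset_of_nonneg
        (Finset.subset_univ _) fun z _ _ => Finset.prod_nonneg fun i _ => hw _
    _ = (∑ x, w x) ^ k := (Fintype.sum_pow w k).symm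
    _ ≤ _ := by
      refine pow_le_pow_left₀ (Finset.sum_nonneg fun x _ => hw x) ?_ k
      calc ∑ x, w x ≤ ∑ x, ((if x ∈ B then 1 else 0) + t) := by
            refine Finset.sum_le_sum fun x _ => ?_
            simp only [w]; split_ifs <;> linarith
        _ = _ := by
            rw [Finset.sum_add_distrib]
            simp [mul_comm]

/-- Small Hamming balls over a finite alphabet have small exponential size. -/
theorem exists_card_ball_le (A : Type*) [Fintype A] [DecidableEq A] {ε : ℝ} (hε : 0 < ε) :
    ∃ δ > 0, ∀ {V : Type} [Fintype V] (x₀ : V → A) (B : Finset (V → A)),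
      (∀ x ∈ B, (∑ v, if x v = x₀ v then (0 : ℝ) else 1) ≤ δ * Fintype.card V) →
      (B.card : ℝ) ≤ Real.exp (ε * Fintype.card V) := by
  classical
  -- The weight `t` keeps each factor `1 + t|A|` below `exp (ε/2)`. The radius chosen afterwards
  -- makes the normalisation `t ^ (-δN)` at most `exp (εN/2)`.
  let t : ℝ := min 1 (ε / (2 * (Fintype.card A + 1)))
  have ht : 0 < t := lt_min one_pos (by positivity)
  have ht1 : t ≤ 1 := min_le_left _ _
  have hta : t * Fintype.card A ≤ ε / 2 := by
    calc t * Fintype.card A ≤ ε / (2 * (Fintype.card A + 1)) * (Fintype.card A + 1) := by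
          gcongr
          · exact min_le_right _ _
          · linarith
      _ = ε / 2 := by field_simp
  have hl : 0 ≤ -Real.log t := by
    have := Real.log_nonpos ht.le ht1; linarith
  refine ⟨ε / (2 * (-Real.log t + 1)), by positivity, fun {V} _ x₀ B hB => ?_⟩
  set δ : ℝ := ε / (2 * (-Real.log t + 1))
  have hδ : δ * -Real.log t ≤ ε / 2 := by
    have hδ0 : 0 ≤ δ := by positivity
    calc δ * -Real.log t ≤ δ * (-Real.log t + 1) := by gcongr; linarith
      _ = ε / 2 := by simp only [δ]; field_simp
  set N : ℝ := (Fintype.card V : ℝ)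
  have hN : 0 ≤ N := by positivity
  let w : V → A → ℝ := fun v x => if x = x₀ v then 1 else t
  have hw : ∀ v x, 0 ≤ w v x := fun v x => by simp only [w]; split_ifs <;> positivity
  have h1 : ∀ x ∈ B, Real.exp (δ * N * Real.log t) ≤ ∏ v, w v (x v) := fun x hx => by
    have : ∏ v, w v (x v) = Real.exp ((∑ v, if x v = x₀ v then (0 : ℝ) else 1) * Real.log t) := by
      rw [Finset.sum_mul, Real.exp_sum]
      refine Finset.prod_congr rfl fun v _ => ?_
      simp only [w]; split_ifs
      · simp
      · rw [one_mul, Real.exp_log ht]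
    rw [this]
    exact Real.exp_le_exp.2 (mul_le_mul_of_nonpos_right (hB x hx) (by linarith))
  have h2 : (B.card : ℝ) * Real.exp (δ * N * Real.log t) ≤ Real.exp (ε / 2 * N) := by
    calc (B.card : ℝ) * Real.exp (δ * N * Real.log t) = ∑ x ∈ B, Real.exp (δ * N * Real.log t) := by
          simp
      _ ≤ ∑ x ∈ B, ∏ v, w v (x v) := Finset.sum_le_sum h1
      _ ≤ ∑ x : V → A, ∏ v, w v (x v) := Finset.sum_le_sum_of_subset_of_nonneg
        (Finset.subset_univ _) fun z _ _ => Finset.prod_nonneg fun i _ => hw _ _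
      _ = ∏ v, ∑ x, w v x := by rw [Finset.prod_univ_sum, Fintype.piFinset_univ]
      _ ≤ ∏ v : V, Real.exp (ε / 2) := by
          refine Finset.prod_le_prod (fun v _ => Finset.sum_nonneg fun x _ => hw v x) fun v _ => ?_
          calc ∑ x, w v x ≤ ∑ x, ((if x = x₀ v then 1 else 0) + t) := by
                refine Finset.sum_le_sum fun x _ => ?_
                simp only [w]; split_ifs <;> linarith
            _ = 1 + t * Fintype.card A := by
                rw [Finset.sum_add_distrib]
                simp [mul_comm]
            _ ≤ ε / 2 + 1 := by linarith
            _ ≤ _ := Real.add_one_le_exp _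
      _ = _ := by rw [Finset.prod_const, Finset.card_univ, ← Real.exp_nat_mul, mul_comm]
  rw [← le_div_iff₀ (Real.exp_pos _), ← Real.exp_sub] at h2
  refine h2.trans (Real.exp_le_exp.2 ?_)
  nlinarith

/-- Take `k`-th roots. The cost of the `N₀` exceptional entries becomes at most `exp (ηN)` because
`k` is large, and `M + θ ≤ M exp θ` with `θ ≤ ηN` costs the second `η`. -/
theorem exp_le_of_mul_pow_le {a θ η c N M : ℝ} {k N₀ : ℕ} (hk : 0 < k) (hN : 1 ≤ N) (hM : 1 ≤ M)
    (hθ : 0 < θ) (hθ1 : θ ≤ 1) (hθη : θ ≤ η) (hkη : N₀ * (-Real.log θ + c) ≤ k * η)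
    (h : Real.exp (k * a * N) * (θ / Real.exp (c * N)) ^ N₀ ≤ (M + θ) ^ k) :
    Real.exp ((a - 2 * η) * N) ≤ M := by
  have hk' : (0 : ℝ) < k := by exact_mod_cast hk
  have hM0 : 0 < M := by linarith
  have h1 : M + θ ≤ M * Real.exp θ := by
    have := Real.add_one_le_exp θ
    nlinarith
  have h2 := h.trans (pow_le_pow_left₀ (by positivity) h1 k)
  have h3 := Real.log_le_log (by positivity) h2
  rw [Real.log_mul (by positivity) (by positivity), Real.log_exp, Real.log_pow, Real.log_pow,
    Real.log_div (by positivity) (by positivity), Real.log_exp,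
    Real.log_mul (by positivity) (by positivity), Real.log_exp] at h3
  rw [← Real.le_log_iff_exp_le hM0]
  have hl : 0 ≤ -Real.log θ := by
    have := Real.log_nonpos hθ.le hθ1; linarith
  have h4 : (N₀ : ℝ) * (-Real.log θ + c * N) ≤ k * η * N := by
    have : (N₀ : ℝ) * (-Real.log θ + c * N) ≤ N₀ * (-Real.log θ + c) * N := by
      have : -Real.log θ ≤ -Real.log θ * N := le_mul_of_one_le_right hl hN
      have h0 : (0 : ℝ) ≤ N₀ := by positivity
      nlinarith [mul_le_mul_of_nonneg_left this h0]
    refine this.trans (mul_le_mul_of_nonneg_right hkη (by linarith))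
  have h5 : θ ≤ η * N := by nlinarith
  have h6 : k * ((a - 2 * η) * N) ≤ k * Real.log M := by
    nlinarith [mul_le_mul_of_nonneg_left h5 hk'.le]
  exact le_of_mul_le_mul_left h6 hk'

/-- Many models over each member of `ΩY` make the covering numbers of a product multiply. -/
theorem exists_cov_le_and_mul_le {A Y V : Type*} [MetricSpace A] [MetricSpace Y] [Fintype V]
    {δ δ₀ M D : ℝ} (hδ : δ + δ ≤ δ₀) (hM : 0 < M) (hD0 : 0 ≤ D)
    {Ω : Set (V → A × Y)} {ΩY : Set (V → Y)} (F : Finset (V → A × Y))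
    (hF : ∀ p ∈ Ω, ∃ q ∈ F, hammingAverage p q < δ)
    (B : (V → Y) → Finset (V → A)) (hB : ∀ y, ∀ x ∈ B y, (fun v => (x v, y v)) ∈ Ω)
    (hBM : ∀ y ∈ ΩY, M ≤ (B y).card)
    (hD : ∀ (x₀ : V → A) (C : Finset (V → A)), (∀ x ∈ C, hammingAverage x x₀ < δ) →
      (C.card : ℝ) ≤ D) :
    ∃ c : ℕ, cov δ₀ ΩY hammingAverage ≤ c ∧ c * M ≤ F.card * D := by
  classical
  have hfst : ∀ p q : V → A × Y, hammingAverage (fun v => (p v).1) (fun v => (q v).1) ≤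
      hammingAverage p q := fun p q => by
    unfold hammingAverage; gcongr; exact le_max_left _ _
  have hsnd : ∀ p q : V → A × Y, hammingAverage (fun v => (p v).2) (fun v => (q v).2) ≤
      hammingAverage p q := fun p q => by
    unfold hammingAverage; gcongr; exact le_max_right _ _
  -- The centres used by the fibre over `y`. Each serves at most `D` points of the fibre, so there
  -- are at least `M / D` of them.
  let E : (V → Y) → Finset (V → A × Y) := fun y => F.filter fun q =>
    ∃ x ∈ B y, hammingAverage (fun v => (x v, y v)) q < δ
  have hE : ∀ y ∈ ΩY, M ≤ (E y).card * D := fun y hy => by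
    refine (hBM y hy).trans ?_
    have hsub : B y ⊆ (E y).biUnion fun q =>
        (B y).filter fun x => hammingAverage x (fun v => (q v).1) < δ := by
      intro x hx
      obtain ⟨q, hq, hlt⟩ := hF _ (hB y x hx)
      refine Finset.mem_biUnion.2 ⟨q, Finset.mem_filter.2 ⟨hq, x, hx, hlt⟩,
        Finset.mem_filter.2 ⟨hx, (hfst (fun v => (x v, y v)) q).trans_lt hlt⟩⟩
    calc ((B y).card : ℝ) ≤ ∑ q ∈ E y,
          (((B y).filter fun x => hammingAverage x (fun v => (q v).1) < δ).card : ℝ) := by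
          exact_mod_cast (Finset.card_le_card hsub).trans Finset.card_biUnion_le
      _ ≤ ∑ q ∈ E y, D := Finset.sum_le_sum fun q _ =>
          hD (fun v => (q v).1) _ fun x hx => (Finset.mem_filter.1 hx).2
      _ = _ := by simp
  have hne : ∀ y ∈ ΩY, (E y).Nonempty := fun y hy => by
    rw [Finset.nonempty_iff_ne_empty]
    intro h0
    have := hE y hy
    rw [h0] at this
    simp at this
    linarith
  -- With constant radius 1 the Vitali lemma is pure combinatorics: it gives a disjoint subfamily
  -- met by every `E y`. Two intersecting sets share a centre, which puts their `y`s within `δ + δ`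
  -- of each other, so the selected `y`s cover `ΩY`; disjointness bounds their number.
  obtain ⟨u, huY, hdis, hcov⟩ := Vitali.exists_disjoint_subfamily_covering_enlargement
    (fun y => (E y : Set (V → A × Y))) ΩY (fun _ => 1) 2 one_lt_two (fun _ _ => zero_le_one) 1
    (fun _ _ => le_rfl) (fun y hy => by exact_mod_cast hne y hy)
  have hclose : ∀ y ∈ ΩY, ∃ y' ∈ u, hammingAverage y y' < δ₀ := fun y hy => by
    obtain ⟨y', hy', ⟨q, hq, hq'⟩, -⟩ := hcov y hy
    obtain ⟨-, x, -, hx⟩ := Finset.mem_filter.1 (Finset.mem_coe.1 hq)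
    obtain ⟨-, x', -, hx'⟩ := Finset.mem_filter.1 (Finset.mem_coe.1 hq')
    refine ⟨y', hy', (hammingAverage_le_of_common (z := fun v => (q v).2)
      ((hsnd (fun v => (x v, y v)) q).trans_lt hx)
      ((hsnd (fun v => (x' v, y' v)) q).trans_lt hx')).trans_le hδ⟩
  have hrep : ∀ y : u, ∃ q, q ∈ E y := fun y => hne y (huY y.2)
  choose r hr using hrep
  have hinj : Function.Injective r := fun y y' h => by
    by_contra hyy
    have := hdis y.2 y'.2 fun h => hyy (Subtype.ext h)
    exact Set.disjoint_left.1 this (Finset.mem_coe.2 (hr y)) (by rw [h]; exact Finset.mem_coe.2 (hr y'))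
  have hufin : u.Finite := by
    have : Finite u := Finite.of_injective (fun y => (⟨r y, (Finset.mem_filter.1 (hr y)).1⟩ : F))
      fun y y' h => hinj (congrArg Subtype.val h)
    exact Set.toFinite u
  refine ⟨hufin.toFinset.card, ?_, ?_⟩
  · refine (cov_le_encard huY hclose).trans ?_
    rw [hufin.encard_eq_coe_toFinset_card]
  · have hsum : ∑ y ∈ hufin.toFinset, (E y).card ≤ F.card := by
      rw [← Finset.card_biUnion]
      · exact Finset.card_le_card (Finset.biUnion_subset.2 fun y _ => Finset.filter_subset _ _)
      · intro y hy y' hy' hyy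
        have := hdis (hufin.mem_toFinset.1 hy) (hufin.mem_toFinset.1 hy') hyy
        exact Finset.disjoint_coe.1 this
    calc (hufin.toFinset.card : ℝ) * M = ∑ y ∈ hufin.toFinset, M := by simp
      _ ≤ ∑ y ∈ hufin.toFinset, (E y).card * D := Finset.sum_le_sum fun y hy =>
          hE y (huY (hufin.mem_toFinset.1 hy))
      _ = ((∑ y ∈ hufin.toFinset, (E y).card : ℕ) : ℝ) * D := by
          rw [Nat.cast_sum, Finset.sum_mul]
      _ ≤ _ := by gcongr

/-! ### Lower bound for the entropy of a product. -/

section Lower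
variable {G A Y : Type*} [Group G] [Countable G]
  [MetricSpace A] [CompactSpace A] [MeasurableSpace A] [BorelSpace A] [Finite A]
  [MetricSpace Y] [CompactSpace Y] [MeasurableSpace Y] [BorelSpace Y]

theorem exists_pos_le_dist (A : Type*) [MetricSpace A] [Finite A] :
    ∃ c > 0, ∀ a b : A, a ≠ b → c ≤ dist a b := by
  have hs := (Set.toFinite {p : A × A | p.1 ≠ p.2})
  rcases Set.eq_empty_or_nonempty {p : A × A | p.1 ≠ p.2} with h | h
  · refine ⟨1, one_pos, fun a b hab => ?_⟩
    have : (a, b) ∈ {p : A × A | p.1 ≠ p.2} := hab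
    rw [h] at this
    exact this.elim
  · obtain ⟨p, hp, hmin⟩ := Set.exists_min_image _ (fun p : A × A => dist p.1 p.2) hs h
    exact ⟨dist p.1 p.2, dist_pos.2 hp, fun a b hab => hmin (a, b) hab⟩

/-- For a finite alphabet, the growth of all powers of one process and the lower entropy of the other
bound the entropy of the product from below. -/
theorem add_le_processEntropy (S : SoficApproximation G)
    (mA : ProbabilityMeasure (G → A)) (mY : ProbabilityMeasure (G → Y))
    (Λ : ProbabilityMeasure (G → A × Y))
    (hΛ : (Λ : Measure (G → A × Y)).map (fun ω => ((fun g => (ω g).1), fun g => (ω g).2)) =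
      (mA : Measure (G → A)).prod (mY : Measure (G → Y)))
    (Λk : ∀ k : ℕ, ProbabilityMeasure (G → Fin k → A))
    (hΛk : ∀ k i j, i ≠ j → (Λk k : Measure (G → Fin k → A)).map
        (fun ω => ((fun g => ω g i), fun g => ω g j)) =
          (mA : Measure (G → A)).prod (mA : Measure (G → A)))
    {a b : ℝ} (ha : ∀ k : ℕ, 1 ≤ k → ((k * a : ℝ) : EReal) < processEntropy S (Λk k))
    (hb : (b : EReal) < lowerProcessEntropy S mY) :
    ((a + b : ℝ) : EReal) ≤ processEntropy S Λ := by
  classical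
  have := Fintype.ofFinite A
  by_contra hcon
  obtain ⟨x, hx₁, hx₂⟩ := EReal.lt_iff_exists_real_btwn.1 (not_le.1 hcon)
  rw [EReal.coe_lt_coe_iff] at hx₂
  refine absurd hx₁ (not_lt.2 ?_)
  -- Three losses are allowed: two in the size of the fibres and one in the size of Hamming balls.
  obtain ⟨η, hη, hxη⟩ : ∃ η > 0, x = a + b - 3 * η := ⟨(a + b - x) / 3, by linarith, by ring⟩
  have hAne : Nonempty A := ⟨mA.nonempty.some 1⟩
  have hcard : (1 : ℝ) ≤ Fintype.card A := by exact_mod_cast Fintype.card_pos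
  obtain ⟨c, hc, hcA⟩ := exists_pos_le_dist A
  obtain ⟨δ₁, hδ₁, hball⟩ := exists_card_ball_le A hη
  obtain ⟨δ₀, hb⟩ := lt_iSup_iff.1 hb
  obtain ⟨hδ₀, hb⟩ := lt_iSup_iff.1 hb
  -- The first bound serves the selection of disjoint fibres. The second makes `δ`-close models over
  -- `A` differ on at most a proportion `δ₁` of the places.
  let δ : ℝ := min (δ₀ / 2) (c * δ₁)
  have hδ : 0 < δ := lt_min (half_pos hδ₀) (mul_pos hc hδ₁)
  refine le_iSup_of_le δ (le_iSup_of_le hδ (le_iInf fun O => le_iInf fun hO => ?_))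
  obtain ⟨N₀, hN₀⟩ := exists_card_bad_le mA mY Λ hΛ hO
  let θ : ℝ := min 1 η
  have hθ : 0 < θ := lt_min one_pos hη
  have hθ1 : θ ≤ 1 := min_le_left _ _
  -- Having `k > N₀` guarantees a good entry in every tuple. The other bound makes `N₀` arbitrary
  -- entries negligible after taking `k`-th roots.
  obtain ⟨k, hk⟩ := exists_nat_gt
    (max (N₀ : ℝ) (N₀ * (-Real.log θ + Real.log (Fintype.card A)) / η))
  have hkN : N₀ < k := by exact_mod_cast (le_max_left _ _).trans_lt hk
  have hk1 : 1 ≤ k := by omega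
  have hkη : N₀ * (-Real.log θ + Real.log (Fintype.card A)) ≤ k * η :=
    ((div_lt_iff₀ hη).1 ((le_max_right _ _).trans_lt hk)).le
  obtain ⟨Ok, hOk, OY, hOY, hbad⟩ := hN₀ k (Λk k) (hΛk k)
  obtain ⟨δ'', ha⟩ := lt_iSup_iff.1 (ha k hk1)
  obtain ⟨hδ'', ha⟩ := lt_iSup_iff.1 ha
  -- The bound for the power holds for infinitely many `n`, that for `mY` for all large `n`. Two
  -- bounds of the first kind might never hold simultaneously.
  have ha' := frequently_lt_of_lt_limsup (by isBoundedDefault)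
    (ha.trans_le (iInf_le_of_le Ok (iInf_le_of_le hOk le_rfl)))
  have hb' := eventually_lt_of_lt_liminf (hb.trans_le (iInf_le_of_le OY (iInf_le_of_le hOY le_rfl)))
  refine le_limsup_of_frequently_le ((ha'.and_eventually hb').mono fun n hn => ?_)
    (by isBoundedDefault)
  obtain ⟨hna, hnb⟩ := hn
  set N : ℝ := (Fintype.card (S.V n) : ℝ) with hNdef
  have hN1 : 1 ≤ N := by
    have : 1 ≤ Fintype.card (S.V n) := Fintype.card_pos
    rw [hNdef]; exact_mod_cast this
  -- the models of the power
  let Z : Finset (Fin k → S.V n → A) :=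
    Finset.univ.filter fun z => (fun v i => z i v) ∈ goodModels Ok (S.σ n)
  have hZ : Real.exp (k * a * N) ≤ Z.card := by
    have h1 := (coe_le_modelRate_iff _).1 hna.le
    -- The alphabet is finite, so a covering number at any scale is at most the number of models;
    -- the scale `δ''` then disappears.
    have h2 : cov δ'' (goodModels Ok (S.σ n)) hammingAverage ≤ Z.card := by
      have : cov δ'' (goodModels Ok (S.σ n)) hammingAverage ≤
          (Z : Set (Fin k → S.V n → A)).encard := by
        refine cov_le_of_label (fun z i v => z v i) (fun z hz => ?_) fun z _ z' _ he => ?_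
        · simpa [Z] using hz
        · have : z = z' := by funext v i; exact congrFun (congrFun he i) v
          rw [this, hammingAverage_self]; exact hδ''
      rwa [Set.encard_coe_eq_coe_finsetCard] at this
    have h3 := h1.trans (ENat.toENNReal_le.2 h2)
    rw [ENat.toENNReal_coe, ← ENNReal.ofReal_natCast] at h3
    exact (ENNReal.ofReal_le_ofReal_iff (Nat.cast_nonneg _)).1 h3
  let B : (S.V n → Y) → Finset (S.V n → A) := fun y =>
    Finset.univ.filter fun x => (fun v => (x v, y v)) ∈ goodModels O (S.σ n)
  have hBM : ∀ y ∈ goodModels OY (S.σ n), Real.exp ((a - 2 * η) * N) ≤ (B y).card := by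
    intro y hy
    have hbadB : ∀ z ∈ Z, {i | z i ∉ B y}.ncard ≤ N₀ := fun z hz => by
      have := hbad (S.σ n) (fun v i => z i v) y (Finset.mem_filter.1 hz).2 hy
      simpa [B] using this
    have hB1 : 1 ≤ (B y).card := by
      by_contra h0
      have h0 : B y = ∅ := by rw [← Finset.card_eq_zero]; omega
      have hZne : Z.Nonempty := by
        rw [← Finset.card_pos]
        exact_mod_cast (Real.exp_pos _).trans_le hZ
      obtain ⟨z, hz⟩ := hZne
      have := hbadB z hz
      rw [h0] at this
      have h1 : {i : Fin k | z i ∉ (∅ : Finset (S.V n → A))} = Set.univ := by ext; simp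
      rw [h1, Set.ncard_univ, Nat.card_eq_fintype_card, Fintype.card_fin] at this
      omega
    refine exp_le_of_mul_pow_le (c := Real.log (Fintype.card A)) (N₀ := N₀) (by omega) hN1
      (by exact_mod_cast hB1) hθ hθ1 (min_le_right _ _) hkη ?_
    have hW : Real.exp (Real.log (Fintype.card A) * N) = Fintype.card (S.V n → A) := by
      rw [mul_comm, hNdef, Real.exp_nat_mul, Real.exp_log (by linarith), Fintype.card_fun]
      push_cast; rfl
    have hWpos : (1 : ℝ) ≤ Fintype.card (S.V n → A) := by
      exact_mod_cast (Fintype.card_pos : 0 < Fintype.card (S.V n → A))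
    -- The weight is scaled by the number `|A|^N` of all models, so that the total weight of the bad
    -- ones is at most `θ`.
    have h1 := card_mul_pow_le Z (B y) hbadB (t := θ / Fintype.card (S.V n → A)) (by positivity)
      (by rw [div_le_one (by linarith)]; linarith)
    rw [div_mul_cancel₀ _ (by linarith)] at h1
    rw [hW]
    refine le_trans ?_ h1
    gcongr
  by_cases hfin : cov δ (goodModels O (S.σ n)) hammingAverage = ⊤
  · rw [coe_le_modelRate_iff, hfin]; simp
  obtain ⟨F, -, hF, hFe⟩ := exists_encard_eq_cov (δ := δ) (Z := goodModels O (S.σ n))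
    (d := hammingAverage) fun z _ => by rwa [hammingAverage_self]
  have hFfin : F.Finite := by
    rw [← Set.encard_ne_top_iff, hFe]; exact hfin
  obtain ⟨q, hq, hqM⟩ := exists_cov_le_and_mul_le (δ := δ) (δ₀ := δ₀)
    (M := Real.exp ((a - 2 * η) * N)) (D := Real.exp (η * N))
    (Ω := goodModels O (S.σ n)) (ΩY := goodModels OY (S.σ n))
    (by have : δ ≤ δ₀ / 2 := min_le_left _ _
        linarith) (Real.exp_pos _) (Real.exp_pos _).le hFfin.toFinset
    (by simpa using hF) B (fun y x hx => (Finset.mem_filter.1 hx).2) hBM (fun x₀ C hC => by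
      refine hball x₀ C fun x hx => ?_
      have h1 : hammingAverage x x₀ < c * δ₁ := (hC x hx).trans_le (min_le_right _ _)
      rw [hammingAverage, div_lt_iff₀ (by linarith), mul_assoc] at h1
      refine le_of_mul_le_mul_left ((Finset.mul_sum _ _ _).le.trans (le_trans ?_ h1.le)) hc
      refine Finset.sum_le_sum fun v _ => ?_
      split_ifs with h
      · simp
      · simpa using hcA _ _ h)
  have hbq : Real.exp (b * N) ≤ q := by
    have h1 := (coe_le_modelRate_iff _).1 hnb.le
    have h3 := h1.trans (ENat.toENNReal_le.2 hq)
    rw [ENat.toENNReal_coe, ← ENNReal.ofReal_natCast] at h3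
    exact (ENNReal.ofReal_le_ofReal_iff (Nat.cast_nonneg _)).1 h3
  rw [coe_le_modelRate_iff, ← hFe, hFfin.encard_eq_coe_toFinset_card, ENat.toENNReal_coe,
    ← ENNReal.ofReal_natCast]
  refine ENNReal.ofReal_le_ofReal ?_
  have h1 : Real.exp (b * N) * Real.exp ((a - 2 * η) * N) ≤ hFfin.toFinset.card * Real.exp (η * N) :=
    (mul_le_mul_of_nonneg_right hbq (Real.exp_pos _).le).trans hqM
  rw [← div_le_iff₀ (Real.exp_pos _), ← Real.exp_add, ← Real.exp_sub] at h1
  refine le_trans (le_of_eq ?_) h1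
  rw [hxη]
  congr 1
  ring

end Lower

/-! ### Powers and products of systems -/

section Powers
variable {G X Y : Type*} [Group G] [MeasurableSpace X] [MulAction G X] [MeasurableConstSMul G X]
  [MeasurableSpace Y] [MulAction G Y] [MeasurableConstSMul G Y]
  (μ : Measure X) [IsProbabilityMeasure μ] (ν : Measure Y) [IsProbabilityMeasure ν]

instance smulInvariantMeasure_power [SMulInvariantMeasure G X μ] (k : ℕ) :
    SMulInvariantMeasure G (Fin k → X) (power μ k) :=
  ⟨fun g _ hs => (measurePreserving_pi (fun _ : Fin k => μ) (fun _ => μ)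
    fun _ => measurePreserving_smul g μ).measure_preimage hs.nullMeasurableSet⟩

instance smulInvariantMeasure_prod [SMulInvariantMeasure G X μ] [SMulInvariantMeasure G Y ν] :
    SMulInvariantMeasure G (X × Y) (μ.prod ν) :=
  ⟨fun g _ hs => ((measurePreserving_smul g μ).prod
    (measurePreserving_smul g ν)).measure_preimage hs.nullMeasurableSet⟩

/-- Restriction to a subfamily of coordinates preserves power measures. -/
theorem measurePreserving_comp_injective {k m : ℕ} {e : Fin m → Fin k}
    (he : Function.Injective e) :
    MeasurePreserving (fun (x : Fin k → X) i => x (e i)) (power μ k) (power μ m) := by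
  classical
  have hm : Measurable fun (x : Fin k → X) i => x (e i) := by fun_prop
  refine ⟨hm, (Measure.pi_eq fun s hs => ?_).symm⟩
  rw [Measure.map_apply hm (MeasurableSet.univ_pi hs)]
  have : (fun (x : Fin k → X) i => x (e i)) ⁻¹' Set.pi Set.univ s =
      Set.pi Set.univ fun j => {a | ∀ i, e i = j → a ∈ s i} := by
    ext x
    simp only [Set.mem_preimage, Set.mem_pi, Set.mem_univ, true_implies, Set.mem_ofPred_eq]
    exact ⟨fun h j i hij => hij ▸ h i, fun h i => h _ i rfl⟩
  rw [this, Measure.pi_pi]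
  refine (Fintype.prod_of_injective e he _ _ (fun j hj => ?_) fun i => ?_).symm
  · have : {a | ∀ i, e i = j → a ∈ s i} = Set.univ := by
      ext a
      simp only [Set.mem_ofPred_eq, Set.mem_univ, iff_true]
      exact fun i hi => absurd ⟨i, hi⟩ hj
    rw [this, measure_univ]
  · congr 1
    ext a
    simp only [Set.mem_ofPred_eq]
    exact ⟨fun h j hj => he hj ▸ h, fun h => h i rfl⟩

theorem measurePreserving_eval_pair {k : ℕ} {i j : Fin k} (hij : i ≠ j) :
    MeasurePreserving (fun x : Fin k → X => (x i, x j)) (power μ k) (μ.prod μ) := by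
  have he : Function.Injective ![i, j] := by
    intro a b
    fin_cases a <;> fin_cases b <;> simp [hij, hij.symm]
  exact (measurePreserving_piFinTwo fun _ : Fin 2 => μ).comp
    (measurePreserving_comp_injective μ he)

/-- Regrouping the coordinates of a power. -/
theorem measurePreserving_finProdFinEquiv (k j : ℕ) :
    MeasurePreserving (fun (x : Fin (k * j) → X) i l => x (finProdFinEquiv (i, l)))
      (power μ (k * j)) (power (power μ j) k) := by
  let e : (Fin (k * j) → X) ≃ᵐ (Fin k → Fin j → X) :=
    { toFun := fun x i l => x (finProdFinEquiv (i, l))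
      invFun := fun y i => y (finProdFinEquiv.symm i).1 (finProdFinEquiv.symm i).2
      left_inv := fun x => by funext i; exact congrArg x (finProdFinEquiv.apply_symm_apply i)
      right_inv := fun y => by funext i l; simp
      measurable_toFun := measurable_pi_lambda _ fun _ => measurable_pi_lambda _ fun _ =>
        measurable_pi_apply _
      measurable_invFun := by
        have : Measurable fun (y : Fin k → Fin j → X) (i : Fin (k * j)) =>
            y (finProdFinEquiv.symm i).1 (finProdFinEquiv.symm i).2 :=
          measurable_pi_lambda _ fun i => (measurable_pi_apply (finProdFinEquiv.symm i).2).comp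
            (measurable_pi_apply (finProdFinEquiv.symm i).1)
        exact this }
  have h : MeasurePreserving e.symm (power (power μ j) k) (power μ (k * j)) := by
    refine ⟨e.symm.measurable, (Measure.pi_eq fun s hs => ?_).symm⟩
    rw [Measure.map_apply e.symm.measurable (MeasurableSet.univ_pi hs)]
    have : e.symm ⁻¹' Set.pi Set.univ s = Set.pi Set.univ fun i =>
        Set.pi Set.univ fun l => s (finProdFinEquiv (i, l)) := by
      ext y
      simp only [Set.mem_preimage, Set.mem_pi, Set.mem_univ, true_implies]
      refine ⟨fun h i l => ?_, fun h i => ?_⟩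
      · have : y (finProdFinEquiv.symm (finProdFinEquiv (i, l))).1
            (finProdFinEquiv.symm (finProdFinEquiv (i, l))).2 ∈ s (finProdFinEquiv (i, l)) :=
          h (finProdFinEquiv (i, l))
        rwa [Equiv.symm_apply_apply] at this
      · have := h (finProdFinEquiv.symm i).1 (finProdFinEquiv.symm i).2
        rw [Prod.mk.eta, Equiv.apply_symm_apply] at this
        exact this
    rw [this, Measure.pi_pi]
    simp only [Measure.pi_pi]
    rw [← Fintype.prod_prod_type' fun i l => μ (s (finProdFinEquiv (i, l))),
      Equiv.prod_comp finProdFinEquiv fun i => μ (s i)]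
  exact h.symm

omit [MeasurableConstSMul G X] in
theorem determines_power {A : Type*} [MeasurableSpace A] {p : X → A}
    (hdet : Determines G μ p id) (k : ℕ) :
    Determines G (power μ k) (fun x i => p (x i)) id := by
  obtain ⟨f, hf, hfe⟩ := hdet
  refine ⟨fun ω i => f fun g => ω g i, measurable_pi_lambda _ fun i => hf.comp (by fun_prop), ?_⟩
  have : ∀ᵐ x ∂power μ k, ∀ i, x i = f (orbitName G p (x i)) := ae_all_iff.2 fun i =>
    (measurePreserving_eval (fun _ : Fin k => μ) i).quasiMeasurePreserving.ae hfe
  filter_upwards [this] with x hx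
  funext i
  exact hx i

omit [MeasurableConstSMul G X] [MeasurableConstSMul G Y] [IsProbabilityMeasure μ] in
theorem determines_prod {A : Type*} [MeasurableSpace A] {p : X → A}
    (hdet : Determines G μ p id) :
    Determines G (μ.prod ν) (fun z : X × Y => (p z.1, z.2)) id := by
  obtain ⟨f, hf, hfe⟩ := hdet
  refine ⟨fun ω => (f fun g => (ω g).1, (ω 1).2), (hf.comp (by fun_prop)).prodMk (by fun_prop), ?_⟩
  have : ∀ᵐ z ∂μ.prod ν, z.1 = f (orbitName G p z.1) :=
    (measurePreserving_fst (μ := μ) (ν := ν)).quasiMeasurePreserving.ae hfe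
  filter_upwards [this] with z hz
  refine Prod.ext hz ?_
  simp [orbitName]

omit [MeasurableConstSMul G X] in
/-- A finite generating partition yields a finite valued observable which determines the system. -/
theorem HasFiniteGeneratingPartition.exists_determines [StandardBorelSpace X]
    (h : HasFiniteGeneratingPartition G μ) :
    ∃ (m : ℕ) (p : X → Fin m), Measurable p ∧ Determines G μ p id := by
  obtain ⟨m, P, hP, hdis, hun, hgen⟩ := h
  have hex : ∀ x, ∃ i, x ∈ P i := fun x => by
    have : x ∈ ⋃ i, P i := hun ▸ Set.mem_univ x
    simpa using this
  choose p hp using hex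
  have hpre : ∀ i, p ⁻¹' {i} = P i := fun i => by
    ext x
    simp only [Set.mem_preimage, Set.mem_singleton_iff]
    refine ⟨fun h => h ▸ hp x, fun h => ?_⟩
    by_contra hne
    exact Set.disjoint_left.1 (hdis hne) (hp x) h
  have hpm : Measurable p := measurable_to_countable' fun i => by rw [hpre]; exact hP i
  refine ⟨m, p, hpm, ?_⟩
  have hne : Nonempty X := nonempty_of_isProbabilityMeasure μ
  -- Countably many measurable sets separate the points of `X`. Each agrees almost everywhere with a
  -- set read off the `P`-name, so almost every point can be recovered from its name.
  have he := MeasurableSpace.measurable_mapNatBool X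
  choose B hB hBe using fun n : ℕ => hgen ((fun x => MeasurableSpace.mapNatBool X x n) ⁻¹' {true})
    (((measurable_pi_apply n).comp he) (measurableSet_singleton true))
  have hle : MeasurableSpace.generateFrom {C | ∃ (g : G) (i : Fin m), C = (fun x => g • x) ⁻¹' P i} ≤
      MeasurableSpace.comap (orbitName G p) inferInstance := by
    refine MeasurableSpace.generateFrom_le ?_
    rintro _ ⟨g, i, rfl⟩
    refine ⟨(fun ω : G → Fin m => ω g) ⁻¹' {i}, (measurable_pi_apply g) (measurableSet_singleton i), ?_⟩
    rw [← hpre]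
    rfl
  choose C hC hCB using fun n => hle _ (hB n)
  classical
  let c : (G → Fin m) → ℕ → Bool := fun ω n => decide (ω ∈ C n)
  have hc : Measurable c := measurable_pi_lambda _ fun n => measurable_to_bool (by
    have : (fun ω => c ω n) ⁻¹' {true} = C n := by ext ω; simp [c]
    rw [this]; exact hC n)
  obtain ⟨r, hr, hre⟩ := (he.measurableEmbedding
    (MeasurableSpace.injective_mapNatBool (α := X))).exists_measurable_extend measurable_id
    fun _ => hne
  refine ⟨r ∘ c, hr.comp hc, ?_⟩
  filter_upwards [ae_all_iff.2 hBe] with x hx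
  have : c (orbitName G p x) = MeasurableSpace.mapNatBool X x := by
    funext n
    have h1 : (MeasurableSpace.mapNatBool X x n = true) ↔ x ∈ B n := iff_of_eq (hx n)
    rw [← hCB n] at h1
    rw [Bool.eq_iff_iff, h1]
    simp [c]
  simp only [Function.comp_apply, this]
  exact (congrFun hre x).symm

end Powers

/-! ### Inequalities between entropies of powers and products. -/

section Bounds
variable {G : Type*} [Group G] [Countable G] (S : SoficApproximation G)
  {X : Type*} [MeasurableSpace X] [StandardBorelSpace X] [MulAction G X] [MeasurableConstSMul G X]
  (μ : Measure X) [IsProbabilityMeasure μ] [SMulInvariantMeasure G X μ]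
  {Y : Type*} [MeasurableSpace Y] [StandardBorelSpace Y] [MulAction G Y] [MeasurableConstSMul G Y]
  (ν : Measure Y) [IsProbabilityMeasure ν] [SMulInvariantMeasure G Y ν]

/-- The growth of all powers of one system and the lower entropy of another bound the entropy of
their product from below. -/
theorem add_le_soficEntropy_prod {A : Type*} [MetricSpace A] [CompactSpace A] [MeasurableSpace A]
    [BorelSpace A] [Finite A] {p : X → A} (hp : Measurable p) (hdet : Determines G μ p id)
    {a b : ℝ} (ha : ∀ k : ℕ, 1 ≤ k → ((k * a : ℝ) : EReal) < soficEntropy S (power μ k))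
    (hb : (b : EReal) < lowerSoficEntropy S ν) :
    ((a + b : ℝ) : EReal) ≤ soficEntropy S (μ.prod ν) := by
  obtain ⟨d, hb⟩ := lt_iSup_iff.1 hb
  let _ := d.metric
  have := d.compact
  have := d.borel
  have hpY : Measurable fun z : X × Y => (p z.1, z.2) :=
    (hp.comp measurable_fst).prodMk measurable_snd
  have hpk : ∀ k, Measurable fun (x : Fin k → X) i => p (x i) := fun k =>
    measurable_pi_lambda _ fun i => hp.comp (measurable_pi_apply i)
  refine le_trans ?_ (processEntropy_le_soficEntropy S (μ.prod ν) hpY (determines_prod μ ν hdet))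
  have hid : Measurable (id : Y → Y) := measurable_id
  refine add_le_processEntropy S (obsLaw G μ hp) (obsLaw G ν hid) _ ?_
    (fun k => obsLaw G (power μ k) (hpk k)) ?_ (fun k hk => ?_) hb
  · change ((μ.prod ν).map _).map _ = (μ.map _).prod (ν.map _)
    rw [Measure.map_map (by fun_prop) (measurable_orbitName hpY),
      Measure.map_prod_map _ _ (measurable_orbitName hp) (measurable_orbitName hid)]
    rfl
  · intro k i j hij
    change ((power μ k).map _).map _ = (μ.map _).prod (μ.map _)
    rw [Measure.map_map (by fun_prop) (measurable_orbitName (hpk k)),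
      Measure.map_prod_map _ _ (measurable_orbitName hp) (measurable_orbitName hp),
      ← (measurePreserving_eval_pair μ hij).map_eq,
      Measure.map_map ((measurable_orbitName hp).prodMap (measurable_orbitName hp))
        (measurePreserving_eval_pair μ hij).measurable]
    rfl
  · exact (ha k hk).trans_le
      (soficEntropy_le_processEntropy S (power μ k) (hpk k) (determines_power μ hdet k))

/-- The power is a joining of its first `m` and last `l` coordinates, which cover all of them.
Overlap is allowed, so a short remaining block, whose entropy is not controlled by that of a longer
one, never has to be used. -/
theorem soficEntropy_power_le_add {k m l : ℕ} (hm : m ≤ k) (hl : l ≤ k) (hk : k ≤ m + l) :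
    soficEntropy S (power μ k) ≤ soficEntropy S (power μ m) + soficEntropy S (power μ l) := by
  let e₁ : Fin m → Fin k := Fin.castLE hm
  let e₂ : Fin l → Fin k := fun i => ⟨i + (k - l), by omega⟩
  have h₁ : Function.Injective e₁ := Fin.castLE_injective hm
  have h₂ : Function.Injective e₂ := fun i j h => by
    have := congrArg Fin.val h
    simp only [e₂] at this
    exact Fin.ext (by omega)
  refine soficEntropy_le_add S (measurePreserving_comp_injective μ h₁)
    (measurePreserving_comp_injective μ h₂) (fun g x => rfl) (fun g x => rfl) fun x y hxy => ?_
  funext i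
  by_cases hi : (i : ℕ) < m
  · exact congrFun (congrArg Prod.fst hxy) ⟨i, hi⟩
  · have := congrFun (congrArg Prod.snd hxy) ⟨i - (k - l), by omega⟩
    have he : e₂ ⟨i - (k - l), by omega⟩ = i := Fin.ext (by simp only [e₂]; omega)
    simpa only [he] using this

/-- Transfers the growth along the powers of `μ` to the powers of the single system `μ^j`. -/
theorem soficEntropy_power_mul_le (k j : ℕ) :
    soficEntropy S (power μ (k * j)) ≤ soficEntropy S (power (power μ j) k) := by
  refine soficEntropy_le_of_injective S (measurePreserving_finProdFinEquiv μ k j)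
    (fun g x => rfl) fun x y hxy => ?_
  funext i
  have := congrFun (congrFun hxy (finProdFinEquiv.symm i).1) (finProdFinEquiv.symm i).2
  simpa only [Prod.mk.eta, Equiv.apply_symm_apply] using this

theorem soficEntropy_prod_power_le (j : ℕ) :
    soficEntropy S ((power μ j).prod (power ν j)) ≤ soficEntropy S (power (μ.prod ν) j) := by
  refine soficEntropy_le_of_injective S
    ((measurePreserving_arrowProdEquivProdArrow X Y (Fin j) (fun _ => μ) fun _ => ν).symm)
    (fun g x => rfl) (MeasurableEquiv.injective _)

theorem soficEntropy_power_prod_le (j : ℕ) :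
    soficEntropy S (power (μ.prod ν) j) ≤
      soficEntropy S (power μ j) + soficEntropy S (power ν j) := by
  refine soficEntropy_le_add S
    (measurePreserving_pi _ _ fun _ => measurePreserving_fst)
    (measurePreserving_pi _ _ fun _ => measurePreserving_snd)
    (fun g x => rfl) (fun g x => rfl) fun x y hxy => ?_
  funext i
  exact Prod.ext (congrFun (congrArg Prod.fst hxy) i) (congrFun (congrArg Prod.snd hxy) i)

/-! ### Existence of the limits -/

theorem soficEntropy_power_le_mul {m : ℕ} (q : ℕ) :
    1 ≤ q → ∀ k, m ≤ k → k ≤ q * m →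
      soficEntropy S (power μ k) ≤ q * soficEntropy S (power μ m) := by
  intro hq
  induction q, hq using Nat.le_induction with
  | base =>
    intro k h1 h2
    have : k = m := by omega
    subst this
    simp
  | succ q hq ih =>
    intro k h1 h2
    have h3 : m ≤ q * m := Nat.le_mul_of_pos_left m hq
    have h4 : (q + 1) * m = q * m + m := by ring
    -- The maximum keeps the first block at length at least `m`, as the induction hypothesis
    -- requires; for `k < 2m` the two blocks overlap.
    refine (soficEntropy_power_le_add S μ (m := max m (k - m)) (l := m) (by omega) h1
      (by omega)).trans ?_
    have := ih (max m (k - m)) (by omega) (by omega)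
    refine (add_le_add_left this _).trans (le_of_eq ?_)
    push_cast
    rw [EReal.right_distrib_of_nonneg (by positivity) zero_le_one, one_mul]

omit [StandardBorelSpace X] [SMulInvariantMeasure G X μ] in
theorem powerRate_nonneg {k : ℕ} (h : soficEntropy S (power μ k) ≠ ⊥) : 0 ≤ powerRate S μ k :=
  EReal.div_nonneg (soficEntropy_nonneg S h) (by positivity)

/-- Cover `k` coordinates by `⌊k/m⌋ + 1` blocks of length `m`; the one extra block is negligible as
`k → ∞`. An infinite value at `m` is treated separately: `⊥` passes to every `k ≥ m`, and `⊤` makes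
the bound trivial. -/
theorem psEntropy_le_powerRate {m : ℕ} (hm : 1 ≤ m) : psEntropy S μ ≤ powerRate S μ m := by
  have hm' : (0 : EReal) < m := by exact_mod_cast hm
  have hle : ∀ k : ℕ, m ≤ k → powerRate S μ k ≤
      ((k / m + 1 : ℕ) : EReal) * soficEntropy S (power μ m) / k := fun k hk => by
    refine EReal.div_le_div_right_of_nonneg (by positivity)
      (soficEntropy_power_le_mul S μ _ (Nat.le_add_left 1 _) k hk ?_)
    have := Nat.lt_div_mul_add (a := k) (by omega : 0 < m)
    rw [add_mul, one_mul]; omega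
  by_cases hb : soficEntropy S (power μ m) = ⊥
  · refine (limsup_le_of_le (by isBoundedDefault) ?_ : psEntropy S μ ≤ ⊥).trans bot_le
    filter_upwards [eventually_ge_atTop m] with k hk
    refine (hle k hk).trans (le_of_eq ?_)
    rw [hb, EReal.mul_bot_of_pos (by exact_mod_cast Nat.succ_pos _),
      EReal.bot_div_of_pos_ne_top (by exact_mod_cast (hm.trans hk)) (natCast_ne_top_ereal _)]
  have h0 := soficEntropy_nonneg S hb
  by_cases ht : soficEntropy S (power μ m) = ⊤
  · rw [powerRate, ht, EReal.top_div_of_pos_ne_top hm' (natCast_ne_top_ereal _)]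
    exact le_top
  obtain ⟨r, hr⟩ : ∃ r : ℝ, soficEntropy S (power μ m) = r :=
    ⟨_, (EReal.coe_toReal ht hb).symm⟩
  have hr0 : 0 ≤ r := by rw [hr] at h0; exact_mod_cast h0
  have hmR : (0 : ℝ) < m := by exact_mod_cast hm
  have hlim : Tendsto (fun k : ℕ => ((r / m + r * (1 / (k : ℝ)) : ℝ) : EReal)) atTop
      (𝓝 ((r / m : ℝ) : EReal)) := by
    have h1 : Tendsto (fun k : ℕ => r / m + r * (1 / (k : ℝ))) atTop (𝓝 (r / m + r * 0)) :=
      (tendsto_one_div_atTop_nhds_zero_nat.const_mul r).const_add _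
    rw [mul_zero, add_zero] at h1
    exact (continuous_coe_real_ereal.tendsto _).comp h1
  have hrate : powerRate S μ m = ((r / m : ℝ) : EReal) := by
    rw [powerRate, hr, EReal.coe_div]; rfl
  rw [hrate, ← hlim.limsup_eq]
  refine limsup_le_limsup ?_
  filter_upwards [eventually_ge_atTop m] with k hk
  refine (hle k hk).trans ?_
  have hkR : (0 : ℝ) < k := lt_of_lt_of_le hmR (by exact_mod_cast hk)
  have h1 : ((k / m + 1 : ℕ) : EReal) * soficEntropy S (power μ m) / k =
      (((k / m + 1 : ℕ) * r / k : ℝ) : EReal) := by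
    rw [hr, EReal.coe_div, EReal.coe_mul]; rfl
  rw [h1, EReal.coe_le_coe_iff]
  have h2 : ((k / m : ℕ) : ℝ) ≤ k / m := Nat.cast_div_le
  push_cast
  calc (((k / m : ℕ) : ℝ) + 1) * r / k ≤ ((k : ℝ) / m + 1) * r / k := by gcongr
    _ = r / m + r * (1 / k) := by field_simp

/-- The limit superior lies below every term with index at least 1, hence below the limit inferior.
-/
theorem tendsto_powerRate : Tendsto (powerRate S μ) atTop (𝓝 (psEntropy S μ)) := by
  refine tendsto_of_le_liminf_of_limsup_le ?_ le_rfl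
  refine le_liminf_of_le (by isBoundedDefault) ?_
  filter_upwards [eventually_ge_atTop 1] with m hm using psEntropy_le_powerRate S μ hm

/-! ### The two inequalities -/

/-- Rates are `⊥` or nonnegative, so they cannot tend to `⊥` without being equal to it. -/
theorem exists_soficEntropy_power_eq_bot (h : psEntropy S μ = ⊥) :
    ∃ k, 1 ≤ k ∧ soficEntropy S (power μ k) = ⊥ := by
  have ht := tendsto_powerRate S μ
  rw [h] at ht
  obtain ⟨k, hk, hk1⟩ := ((ht.eventually (gt_mem_nhds EReal.bot_lt_zero)).and
    (eventually_ge_atTop 1)).exists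
  refine ⟨k, hk1, ?_⟩
  by_contra hb
  exact absurd hk (not_lt.2 (powerRate_nonneg S μ hb))

theorem powerRate_prod_le (k : ℕ) :
    powerRate S (μ.prod ν) k ≤ powerRate S μ k + powerRate S ν k := by
  unfold powerRate
  rw [← EReal.add_div_of_nonneg_right (by positivity)]
  exact EReal.div_le_div_right_of_nonneg (by positivity) (soficEntropy_power_prod_le S μ ν k)

/-- Passing to the limit in a sum fails at `⊥ + ⊤`. If one limit is `⊥`, some power already has
entropy `⊥`, and `⊥` absorbs every summand. -/
theorem psEntropy_prod_le : psEntropy S (μ.prod ν) ≤ psEntropy S μ + psEntropy S ν := by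
  have hbot : ∀ k, 1 ≤ k → powerRate S μ k + powerRate S ν k = ⊥ → psEntropy S (μ.prod ν) = ⊥ :=
    fun k hk h => le_bot_iff.1 ((psEntropy_le_powerRate S (μ.prod ν) hk).trans
      ((powerRate_prod_le S μ ν k).trans h.le))
  by_cases hμ : psEntropy S μ = ⊥
  · obtain ⟨k, hk, hb⟩ := exists_soficEntropy_power_eq_bot S μ hμ
    refine (hbot k hk ?_).trans_le bot_le
    rw [powerRate, hb, EReal.bot_div_of_pos_ne_top (by exact_mod_cast hk) (natCast_ne_top_ereal _),
      EReal.bot_add]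
  by_cases hν : psEntropy S ν = ⊥
  · obtain ⟨k, hk, hb⟩ := exists_soficEntropy_power_eq_bot S ν hν
    refine (hbot k hk ?_).trans_le bot_le
    rw [powerRate.eq_def S ν, hb,
      EReal.bot_div_of_pos_ne_top (by exact_mod_cast hk) (natCast_ne_top_ereal _), EReal.add_bot]
  refine EReal.le_add_of_forall_gt (.inl hμ) (.inr hν) fun a ha b hb => ?_
  obtain ⟨k, ⟨h1, h2⟩, hk⟩ := (((tendsto_powerRate S μ).eventually (gt_mem_nhds ha)).and
    ((tendsto_powerRate S ν).eventually (gt_mem_nhds hb))).and (eventually_ge_atTop 1) |>.exists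
  exact (psEntropy_le_powerRate S (μ.prod ν) hk).trans
    ((powerRate_prod_le S μ ν k).trans (add_le_add h1.le h2.le))

/-- The bound is proved at each level `j`, by applying `add_le_soficEntropy_prod` to `μ^j` and
`ν^j`. A limiting rate is a lower bound for the rate at every level, which supplies the growth of
all powers of `μ^j`. -/
theorem le_psEntropy_prod (hμ : HasFiniteGeneratingPartition G μ)
    (hν : ∀ k : ℕ, 1 ≤ k → soficEntropy S (power ν k) = lowerSoficEntropy S (power ν k)) :
    psEntropy S μ + psEntropy S ν ≤ psEntropy S (μ.prod ν) := by
  obtain ⟨m, p, hp, hdet⟩ := HasFiniteGeneratingPartition.exists_determines μ hμ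
  refine ge_of_tendsto (tendsto_powerRate S (μ.prod ν)) ?_
  filter_upwards [eventually_ge_atTop 1] with j hj
  have hjpos : (0 : EReal) < j := by exact_mod_cast hj
  refine EReal.add_le_of_forall_lt fun a' ha' b' hb' => ?_
  obtain ⟨a, haa, ha⟩ := EReal.lt_iff_exists_real_btwn.1 ha'
  obtain ⟨b, hbb, hb⟩ := EReal.lt_iff_exists_real_btwn.1 hb'
  refine (add_le_add haa.le hbb.le).trans ?_
  unfold powerRate
  rw [EReal.le_div_iff_mul_le hjpos (natCast_ne_top_ereal _), ← EReal.coe_add, coe_mul_natCast,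
    add_mul]
  refine le_trans ?_ (soficEntropy_prod_power_le S μ ν j)
  let _ : MetricSpace (Fin j → Fin m) := TopologicalSpace.metrizableSpaceMetric _
  refine add_le_soficEntropy_prod S (power μ j) (power ν j) (p := fun x i => p (x i))
    (measurable_pi_lambda _ fun i => hp.comp (measurable_pi_apply i)) (determines_power μ hdet j)
    (fun k hk => ?_) ?_
  · refine lt_of_lt_of_le ?_ (soficEntropy_power_mul_le S μ k j)
    have hkj : 1 ≤ k * j := Nat.mul_pos hk hj
    have := ha.trans_le (psEntropy_le_powerRate S μ hkj)
    rw [powerRate, EReal.lt_div_iff (by exact_mod_cast hkj) (natCast_ne_top_ereal _),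
      coe_mul_natCast] at this
    refine lt_of_eq_of_lt ?_ this
    congr 1
    push_cast; ring
  -- The bound available for `ν^j` concerns its upper entropy; the hypothesis turns it into one for
  -- the lower entropy.
  · rw [← hν j hj, ← coe_mul_natCast, ← EReal.lt_div_iff hjpos (natCast_ne_top_ereal _)]
    exact hb.trans_le (psEntropy_le_powerRate S ν hj)

end Bounds

end SoficEntropy

end

theorem mainTheorem12 {G : Type*} [Group G] [Countable G]
    (S : SoficEntropy.SoficApproximation G)
    {X : Type*} [MeasurableSpace X] [StandardBorelSpace X]
    [MulAction G X] [MeasurableConstSMul G X]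
    (μ : Measure X) [IsProbabilityMeasure μ] [SMulInvariantMeasure G X μ]
    {Y : Type*} [MeasurableSpace Y] [StandardBorelSpace Y]
    [MulAction G Y] [MeasurableConstSMul G Y]
    (ν : Measure Y) [IsProbabilityMeasure ν] [SMulInvariantMeasure G Y ν]
    (hμ : SoficEntropy.HasFiniteGeneratingPartition G μ)
    (hν : ∀ k : ℕ, 1 ≤ k → SoficEntropy.soficEntropy S (SoficEntropy.power ν k) =
      SoficEntropy.lowerSoficEntropy S (SoficEntropy.power ν k)) :
    Tendsto (SoficEntropy.powerRate S μ) atTop (𝓝 (SoficEntropy.psEntropy S μ)) ∧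
    Tendsto (SoficEntropy.powerRate S ν) atTop (𝓝 (SoficEntropy.psEntropy S ν)) ∧
    Tendsto (SoficEntropy.powerRate S (μ.prod ν)) atTop
      (𝓝 (SoficEntropy.psEntropy S (μ.prod ν))) ∧
    SoficEntropy.psEntropy S (μ.prod ν) =
      SoficEntropy.psEntropy S μ + SoficEntropy.psEntropy S ν := by
  exact ⟨SoficEntropy.tendsto_powerRate S μ, SoficEntropy.tendsto_powerRate S ν,
    SoficEntropy.tendsto_powerRate S (μ.prod ν),
    le_antisymm (SoficEntropy.psEntropy_prod_le S μ ν)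
      (SoficEntropy.le_psEntropy_prod S μ ν hμ hν)⟩
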